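/- **Model.** A base station serves RT users $i\in\mathcal N_R$ and NRT users $i\in\mathcal N_{NR}$ (finite sets, $\mathcal N_{NR}\neq\emptyset$), $\mathcal N=\mathcal N_R\cup\mathcal N_{NR}$, $N_{NR}=|\mathcal N_{NR}|$, in slots $k=1,2,\dots$ of duration $T_s>0$. In each slot user $i$ has a channel gain $\gamma_i(k)\in[0,\gamma_{\max}]$ with an atomless law and an arrival indicator $a_i(k)\in\{0,1\}$ with $\mathbb E[a_i(k)]=\lambda_i$; gains and arrivals are independent across users and of each other, and i.i.d. over slots. A (slot-based) policy chooses in each slot, from the present and past gains and arrivals and possibly private randomisation independent of future slots, powers $P_i(k)$ and durations $\mu_i(k)$ for $i\in\mathcal N$, and admissions $r_i(k)\in\{0,1\}$ for $i\in\mathcal N_{NR}$. Packets have $L>0$ bits; $P_{\rm avg},P_{\max}>0$, $q_i\in[0,1]$. With $R_i(k)=\log(1+P_i(k)\gamma_i(k))$ put, for $i\in\mathcal N_{NR}$, $Q_i(1)=0$, $$Q_i(k+1)=\big(Q_i(k)+Lr_i(k)-\mu_i(k)R_i(k)\big)^+,\qquad D_i(k)=\min\{\mu_i(k)R_i(k),\,Q_i(k)+Lr_i(k)\},$$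 where $D_i(k)$ is the number of delivered bits. **Problem.** Maximise the NRT sum throughput $$\bar T=\liminf_{K\to\infty}\frac1K\sum_{k=1}^K\mathbb E\Big[\sum_{i\in\mathcal N_{NR}}\frac{D_i(k)}L\Big]$$ over policies such that, almost surely in every slot, $r_i(k)\le a_i(k)$ for $i\in\mathcal N_{NR}$; $0\le P_i(k)\le P_{\max}$, $\mu_i(k)\ge0$ for $i\in\mathcal N$; $\sum_{i\in\mathcal N}\mu_i(k)=T_s$; for $i\in\mathcal N_R$ either $\mu_i(k)=0$ or $R_i(k)>0$ and $\mu_i(k)=L/R_i(k)$; and such that * (NRT stability) $\limsup_{k}\mathbb E[Q_i(k)]<\infty$ for $i\in\mathcal N_{NR}$; * (RT QoS) $\liminf_{K}\frac1K\sum_{k=1}^K\mathbb E[\mu_i(k)R_i(k)/L]\ge\lambda_iq_i$ for $i\in\mathcal N_R$; * (average power) $\limsup_{K}\frac1K\sum_{k=1}^K\mathbb E\big[\sum_{i\in\mathcal N}P_i(k)\mu_i(k)/T_s\big]\le P_{\rm avg}$. Let $\bar T^*$ be the supremum of $\bar T$ over all feasible policies. **Lambert-Strict algorithm** with parameter $B_{\max}>0$.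 It keeps $X(1)=0$, $Y_i(1)=0$ ($i\in\mathcal N_R$), $$X(k+1)=\Big(X(k)+\tfrac1{T_s}\sum_{i\in\mathcal N}P_i(k)\mu_i(k)-P_{\rm avg}\Big)^+,\qquad Y_i(k+1)=\big(Y_i(k)+a_i(k)q_i-\mathbf 1\{\mu_i(k)\ne0\}\big)^+ .$$ In slot $k$ (index $k$ dropped, ties broken arbitrarily): 1. For $i\in\mathcal N_{NR}$: $r_i=a_i$ if $Q_i<B_{\max}$ and $r_i=0$ otherwise. Let $P_i^{w}=\min\{(T_sQ_i/X-1/\gamma_i)^+,P_{\max}\}$ and $\Psi_i=Q_i\log(1+P_i^{w}\gamma_i)-XP_i^{w}/T_s$; choose $i^*\in\arg\max_{i\in\mathcal N_{NR}}\Psi_i$. (Here $P_i^{w}=0$ if $Q_i=0$ or $\gamma_i=0$, and otherwise $P_i^w=P_{\max}$ if $X=0$.) 2. Discard $S\subseteq\mathcal N_R$ if there are $i\in\mathcal N_R\setminus S$, $j\in S$ with $Y_i>Y_j$ and $\gamma_i>\gamma_j$. For every other $S$ find $\phi\ge0$ such that the powers, for $i\in S$, $$P_i=\min\Big\{\frac1{\gamma_i}\Big[\frac{\tilde\phi\gamma_i-1}{W\big((\tilde\phi\gamma_i-1)/e\big)}-1\Big],P_{\max}\Big\},\qquad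 \tilde\phi=\frac{(\Psi_{i^*}+\phi)T_s}{X},$$ where $W$ is the principal Lambert function and the quotient $c/W(c/e)$ is read as $e$ at $c=0$ ($P_i=P_{\max}$ if $X=0$), give $R_i=\log(1+P_i\gamma_i)>0$ and, with $\tau=T_s-\sum_{i\in S}L/R_i$, satisfy $\tau\ge0$ and $\phi\,\tau=0$. If there is no such $\phi$, discard $S$. Otherwise assign to $S$ the value $\sum_{i\in S}\big(Y_i-\frac{L}{T_sR_i}XP_i\big)+\Psi_{i^*}\tau$. 3. Take $S$ of maximal value with its powers; set $\mu_i=L/R_i$ for $i\in S$, $\mu_{i^*}=\tau$, $P_{i^*}=P_{i^*}^{w}$, and let all other powers and durations be zero. **Theorem.** Suppose the problem is feasible and let $B_{\max}>0$. Then $\bar T^*<\infty$, the Lambert-Strict algorithm can be carried out as a policy, and, whatever the tie-breaking, it satisfies all constraints of the problem (RT QoS, average power, NRT queue stability and the per-slot constraints) and its NRT sum throughput satisfies $$\bar T\ \ge\ \bar T^*-\frac{C_1}{L\,B_{\max}},$$ $$C_1=\sum_{i\in\mathcal N_R}(q_i^2+1)+P_{\max}^2+P_{\rm avg}^2+N_{NR}L^2+N_{NR}T_s^2R_{\max}^2,\qquad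 R_{\max}=\log(1+P_{\max}\gamma_{\max}).$$ -/

import Mathlib

open MeasureTheory ProbabilityTheory Filter

noncomputable section

namespace Downlink

/-- The users: `Sum.inl i` is the real-time (RT) user `i`, `Sum.inr j` the non-real-time (NRT)
user `j`. -/
abbrev User (nR nN : ℕ) : Type := Fin nR ⊕ Fin nN

/-- The data of the downlink system with continuous fading channels. -/
structure Model (nR nN : ℕ) where
  /-- bits per packet -/
  L : ℝ
  /-- slot duration -/
  Ts : ℝ
  /-- average power budget -/
  Pavg : ℝ
  /-- peak power -/
  Pmax : ℝ
  /-- largest channel gain -/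
  gmax : ℝ
  /-- required fraction of RT packets delivered by their deadline -/
  q : Fin nR → ℝ
  /-- arrival rates, in packets per slot -/
  lam : User nR nN → ℝ
  /-- law of the channel power gain of each user -/
  chan : User nR nN → Measure ℝ
  L_pos : 0 < L
  Ts_pos : 0 < Ts
  Pavg_pos : 0 < Pavg
  Pmax_pos : 0 < Pmax
  q_mem : ∀ i, q i ∈ Set.Icc (0 : ℝ) 1
  lam_mem : ∀ u, lam u ∈ Set.Icc (0 : ℝ) 1
  chan_prob : ∀ u, IsProbabilityMeasure (chan u)
  chan_supp : ∀ u, chan u (Set.Icc 0 gmax)ᶜ = 0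
  /-- continuous fading: the distribution function of every gain is continuous -/
  chan_cont : ∀ u x, chan u {x} = 0

variable {nR nN : ℕ}

/-- A probability space carrying the channel gains and the packet arrivals. Slots are numbered
`0, 1, 2, …`. The σ-algebra `ℱ k` is the information available to the base station when it takes
its decisions in slot `k`; it contains the gains and arrivals up to slot `k`, and possibly
further randomisation. -/
structure Realization (M : Model nR nN) where
  Ω : Type
  mΩ : MeasurableSpace Ω
  P : Measure Ω
  prob : IsProbabilityMeasure P
  ℱ : Filtration ℕ mΩ
  gain : ℕ → User nR nN → Ω → ℝ
  arr : ℕ → User nR nN → Ω → ℝ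
  gain_meas : ∀ k u, Measurable[ℱ k] (gain k u)
  arr_meas : ∀ k u, Measurable[ℱ k] (arr k u)
  arr_mem : ∀ k u ω, arr k u ω = 0 ∨ arr k u ω = 1
  gain_law : ∀ k u, P.map (gain k u) = M.chan u
  arr_law : ∀ k u, P.real {ω | arr k u ω = 1} = M.lam u
  /-- within a slot, all gains and all arrivals are independent -/
  indep_users : ∀ k, iIndepFun
    (fun s : User nR nN ⊕ User nR nN => Sum.elim (gain k) (arr k) s) P
  /-- the gains and arrivals of a slot are independent of everything known in earlier slots -/
  indep_past : ∀ k, Indep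
    (MeasurableSpace.comap
      (fun ω (u : User nR nN) => (gain (k + 1) u ω, arr (k + 1) u ω)) inferInstance)
    (ℱ k) P

attribute [instance] Realization.mΩ Realization.prob

/-- A slot-based policy: transmission durations, transmission powers and admission decisions,
each chosen at the beginning of the slot from the information available there. -/
structure Policy {M : Model nR nN} (E : Realization M) where
  dur : ℕ → User nR nN → E.Ω → ℝ
  pow : ℕ → User nR nN → E.Ω → ℝ
  adm : ℕ → Fin nN → E.Ω → ℝ
  dur_meas : ∀ k u, Measurable[E.ℱ k] (dur k u)
  pow_meas : ∀ k u, Measurable[E.ℱ k] (pow k u)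
  adm_meas : ∀ k j, Measurable[E.ℱ k] (adm k j)

/-- Channel capacity at power `p` and gain `g`. -/
def capacity (p g : ℝ) : ℝ := Real.log (1 + p * g)

/-- Time average `(1 / K) ∑_{k < K} f k`. -/
def timeAvg (f : ℕ → ℝ) (K : ℕ) : ℝ := (∑ k ∈ Finset.range K, f k) / K

namespace Policy

variable {M : Model nR nN} {E : Realization M} (π : Policy E)

/-- Transmission rate of user `u` in slot `k`. -/
def rate (k : ℕ) (u : User nR nN) (ω : E.Ω) : ℝ := capacity (π.pow k u ω) (E.gain k u ω)

/-- Average power spent over slot `k`. -/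
def slotPower (k : ℕ) (ω : E.Ω) : ℝ := (∑ u, π.pow k u ω * π.dur k u ω) / M.Ts

/-- Data queue (in bits) of the NRT user `j` at the beginning of slot `k`. -/
def Q : ℕ → Fin nN → E.Ω → ℝ
  | 0, _, _ => 0
  | k + 1, j, ω =>
      max (Q k j ω + M.L * π.adm k j ω - π.dur k (Sum.inr j) ω * π.rate k (Sum.inr j) ω) 0

/-- Virtual queue of the QoS constraint of the RT user `i`. -/
def Y : ℕ → Fin nR → E.Ω → ℝ
  | 0, _, _ => 0
  | k + 1, i, ω =>
      max (Y k i ω + E.arr k (Sum.inl i) ω * M.q i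
        - (if π.dur k (Sum.inl i) ω = 0 then 0 else 1)) 0

/-- Virtual queue of the average power constraint. -/
def X : ℕ → E.Ω → ℝ
  | 0, _ => 0
  | k + 1, ω => max (X k ω + π.slotPower k ω - M.Pavg) 0

/-- Bits of NRT user `j` delivered in slot `k`: what the allotted time and power can carry, as
far as the queue holds data. -/
def delivered (k : ℕ) (j : Fin nN) (ω : E.Ω) : ℝ :=
  min (π.dur k (Sum.inr j) ω * π.rate k (Sum.inr j) ω) (π.Q k j ω + M.L * π.adm k j ω)

/-- Average rate of RT user `i`, in packets per slot. -/
def rtRate (i : Fin nR) : ℝ :=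
  liminf (timeAvg fun k => ∫ ω, π.dur k (Sum.inl i) ω * π.rate k (Sum.inl i) ω / M.L ∂E.P) atTop

/-- Average sum throughput of the NRT users, in packets per slot. -/
def throughput : ℝ :=
  liminf (timeAvg fun k => ∫ ω, (∑ j, π.delivered k j ω) / M.L ∂E.P) atTop

/-- The constraints of the throughput maximisation problem. -/
structure IsFeasible : Prop where
  /-- admission decisions are binary and only arrived packets are admitted -/
  admission : ∀ k, ∀ᵐ ω ∂E.P, ∀ j,
    (π.adm k j ω = 0 ∨ π.adm k j ω = 1) ∧ π.adm k j ω ≤ E.arr k (Sum.inr j) ω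
  /-- stability of the NRT queues -/
  stable : ∀ j, limsup (fun k => ∫⁻ ω, ENNReal.ofReal (π.Q k j ω) ∂E.P) atTop < ⊤
  /-- QoS of the RT users -/
  qos : ∀ i, M.lam (Sum.inl i) * M.q i ≤ π.rtRate i
  avgPower : limsup (timeAvg fun k => ∫ ω, π.slotPower k ω ∂E.P) atTop ≤ M.Pavg
  peakPower : ∀ k, ∀ᵐ ω ∂E.P, ∀ u, 0 ≤ π.pow k u ω ∧ π.pow k u ω ≤ M.Pmax
  dur_nonneg : ∀ k, ∀ᵐ ω ∂E.P, ∀ u, 0 ≤ π.dur k u ω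
  dur_sum : ∀ k, ∀ᵐ ω ∂E.P, ∑ u, π.dur k u ω = M.Ts
  /-- a scheduled RT user gets exactly the time needed for one packet -/
  rt_packet : ∀ k, ∀ᵐ ω ∂E.P, ∀ i, π.dur k (Sum.inl i) ω = 0 ∨
    (0 < π.rate k (Sum.inl i) ω ∧
      π.dur k (Sum.inl i) ω = M.L / π.rate k (Sum.inl i) ω)

end Policy

/-- Principal branch of the Lambert function: for `x ≥ -1/e` the largest `w ≥ -1` with
`w * exp w = x`. -/
def lambertW (x : ℝ) : ℝ := sSup {w : ℝ | -1 ≤ w ∧ w * Real.exp w ≤ x}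

/-- `c / W(c / e)`, with its limit `e` at the removable singularity `c = 0`. -/
def lambertRatio (c : ℝ) : ℝ :=
  if c = 0 then Real.exp 1 else c / lambertW (c / Real.exp 1)

namespace Model

variable (M : Model nR nN)

/-- Water-filling power of an NRT user with queue `Q` and gain `g`:
`min ((Ts Q / X - 1 / g)⁺, Pmax)`. The quotients are read as `+∞` when the denominator is zero,
except that an NRT user without data gets no power. -/
def waterPower (Q X g : ℝ) : ℝ :=
  if g = 0 ∨ Q = 0 then 0
  else if X = 0 then M.Pmax
  else min (max (M.Ts * Q / X - 1 / g) 0) M.Pmax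

/-- Value per unit time of serving an NRT user at its water-filling power. -/
def psiN (Q X g : ℝ) : ℝ :=
  Q * capacity (M.waterPower Q X g) g - X * M.waterPower Q X g / M.Ts

/-- Lambert power of an RT user with gain `g`, where `ψ` is the value per unit time of the chosen
NRT user and `φ` the multiplier of the slot duration. For `X = 0` the quotient
`(ψ + φ) Ts / X` is read as `+∞`. -/
def lambertPower (X ψ φ g : ℝ) : ℝ :=
  if X = 0 then M.Pmax
  else min (1 / g * (lambertRatio ((ψ + φ) * M.Ts / X * g - 1) - 1)) M.Pmax

/-- Time taken by the RT users in `S` at powers `p` and gains `g`. -/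
def rtTime (g p : Fin nR → ℝ) (S : Finset (Fin nR)) : ℝ :=
  ∑ i ∈ S, M.L / capacity (p i) (g i)

/-- `p` are the powers that the search for the multiplier `φ` returns for the RT set `S`: Lambert
powers with `φ ≥ 0` for which the time left for NRT data is nonnegative and is zero unless
`φ = 0`. -/
def IsSearchResult (X ψ : ℝ) (g : Fin nR → ℝ) (S : Finset (Fin nR)) (p : Fin nR → ℝ) : Prop :=
  ∃ φ : ℝ, 0 ≤ φ ∧
    (∀ i ∈ S, p i = M.lambertPower X ψ φ (g i) ∧ 0 < capacity (p i) (g i)) ∧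
    M.rtTime g p S ≤ M.Ts ∧
    φ * (M.Ts - M.rtTime g p S) = 0

/-- The sets that the algorithm discards without evaluating them. -/
def Discarded (Y g : Fin nR → ℝ) (S : Finset (Fin nR)) : Prop :=
  ∃ i, i ∉ S ∧ ∃ j ∈ S, Y j < Y i ∧ g j < g i

/-- Objective of the per-slot problem at the RT set `S` with powers `p`. -/
def setValue (X ψ : ℝ) (Y g : Fin nR → ℝ) (S : Finset (Fin nR)) (p : Fin nR → ℝ) : ℝ :=
  ∑ i ∈ S, (Y i - M.L / (M.Ts * capacity (p i) (g i)) * X * p i) + ψ * (M.Ts - M.rtTime g p S)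

/-- One slot of the Lambert-Strict algorithm with control parameter `B`: from the queues
`Y, Q, X`, the gains `g` and the NRT arrivals `a` to durations, powers and admissions. Ties may be
broken in any way. -/
def LambertStrictStep (B : ℝ) (Y : Fin nR → ℝ) (Q : Fin nN → ℝ) (X : ℝ)
    (g : User nR nN → ℝ) (a : Fin nN → ℝ)
    (dur pow : User nR nN → ℝ) (adm : Fin nN → ℝ) : Prop :=
  (∀ j, adm j = if Q j < B then a j else 0) ∧
  ∃ (s : Fin nN) (S : Finset (Fin nR)) (p : Fin nR → ℝ) (ψ : ℝ),
    ψ = M.psiN (Q s) X (g (Sum.inr s)) ∧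
    (∀ j, M.psiN (Q j) X (g (Sum.inr j)) ≤ ψ) ∧
    ¬ Discarded Y (fun i => g (Sum.inl i)) S ∧
    M.IsSearchResult X ψ (fun i => g (Sum.inl i)) S p ∧
    (∀ S' p', ¬ Discarded Y (fun i => g (Sum.inl i)) S' →
      M.IsSearchResult X ψ (fun i => g (Sum.inl i)) S' p' →
      M.setValue X ψ Y (fun i => g (Sum.inl i)) S' p' ≤
        M.setValue X ψ Y (fun i => g (Sum.inl i)) S p) ∧
    (∀ i, pow (Sum.inl i) = if i ∈ S then p i else 0) ∧
    (∀ i, dur (Sum.inl i) = if i ∈ S then M.L / capacity (p i) (g (Sum.inl i)) else 0) ∧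
    (∀ j, pow (Sum.inr j) = if j = s then M.waterPower (Q s) X (g (Sum.inr s)) else 0) ∧
    (∀ j, dur (Sum.inr j) =
      if j = s then M.Ts - M.rtTime (fun i => g (Sum.inl i)) p S else 0)

/-- Largest possible transmission rate. -/
def Rmax : ℝ := capacity M.Pmax M.gmax

/-- The constant `C₁`. -/
def C₁ : ℝ :=
  ∑ i, (M.q i ^ 2 + 1) + M.Pmax ^ 2 + M.Pavg ^ 2 + nN * M.L ^ 2 + nN * M.Ts ^ 2 * M.Rmax ^ 2

/-- The problem has a feasible policy. -/
def Feasible : Prop := ∃ (E : Realization M) (π : Policy E), π.IsFeasible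

/-- The NRT sum throughputs of all feasible policies. -/
def achievable : Set ℝ :=
  {v | ∃ (E : Realization M) (π : Policy E), π.IsFeasible ∧ π.throughput = v}

/-- The optimal value of the problem. -/
def optThroughput : ℝ := sSup M.achievable

end Model

/-- In every slot, `π` takes the decisions of the Lambert-Strict algorithm. -/
def Policy.IsLambertStrict {M : Model nR nN} {E : Realization M} (π : Policy E) (B : ℝ) : Prop :=
  ∀ k, ∀ᵐ ω ∂E.P,
    M.LambertStrictStep B (fun i => π.Y k i ω) (fun j => π.Q k j ω) (π.X k ω)
      (fun u => E.gain k u ω) (fun j => E.arr k (Sum.inr j) ω)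
      (fun u => π.dur k u ω) (fun u => π.pow k u ω) (fun j => π.adm k j ω)

end Downlink

end

noncomputable section

namespace Downlink

/-! ### The Lambert function -/

/-! The argument is drift plus penalty with weight `B = Bmax`. Let `V` be half the sum of the
squares of all queues `Y i`, `Q j`, `X`. Squaring the queue recursions bounds the increment of `V`
in a slot by `C₁ / 2 + ∑ Y a q + ∑ Q L r - X Pavg` minus the per-slot objective `slotObj`. After
subtracting the reward `B L ∑ r`, the admissions enter through `-∑ (B - Q j) L (r j)`, which the
threshold rule minimises; the remaining decisions enter only through `slotObj`, which the algorithm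
maximises.

That maximisation is exact (`LambertStrictStep.slotObj_le`). The time left over by an RT set `S` is
worth most when one NRT user of maximal `Ψ` gets all of it. For fixed `S`, a multiplier `φ` for the
slot length decouples the users: each minimises the cost `(X p / Ts + ψ + φ) / log (1 + p g)` per
bit, and the stationarity equation `u log u - u = c` in `u = 1 + p g` is what the Lambert function
solves. The least `φ` at which `S` fits into the slot satisfies complementary slackness, so weak
duality makes its powers optimal. An exchange argument shows that discarded sets are never optimal.

The competitor is reduced to numbers: by compactness, the time averages of a feasible policy yield
delivery rates `d` such that, for all fixed nonnegative weights `Y, Q, X`, the quantity `∑ Y λ q + ∑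
Q d - X Pavg` is at most the mean of the per-slot optimum over the gains
(`IsFeasible.exists_rates`). The queues of the algorithm are independent of the current gains, so
they may be inserted as weights (`IsRegular.integral_optimum_ge`).

Together these give `E V (k + 1) + B ∑ d ≤ E V k + C₁ / 2 + B L ∑ E r`
(`IsLambertStrict.integral_lyapunov_succ_le`). Summed over slots, the admitted bits fall short of `∑
d` by at most `C₁ / (2 B)` per slot on average. The threshold keeps every data queue below `B + L`,
so delivered and admitted bits have the same averages. The same inequality gives `E V K = O(K)`,
hence `E X K` and `E Y K` are `O(√K)`, and these two bounds are the power and QoS constraints. -/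

lemma lambertW_mul_exp {w : ℝ} (hw : -1 ≤ w) : lambertW (w * Real.exp w) = w := by
  have hmono : StrictMonoOn (fun w : ℝ => w * Real.exp w) (Set.Ici (-1)) := by
    refine strictMonoOn_of_deriv_pos (convex_Ici _) (by fun_prop) fun x hx => ?_
    rw [interior_Ici, Set.mem_Ioi] at hx
    have h : HasDerivAt (fun w : ℝ => w * Real.exp w) (1 * Real.exp x + x * Real.exp x) x :=
      (hasDerivAt_id x).mul (Real.hasDerivAt_exp x)
    rw [h.deriv, ← add_mul]
    exact mul_pos (by linarith) (Real.exp_pos x)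
  -- By monotonicity of `v * exp v` on `[-1, ∞)`, the set whose supremum defines `lambertW` is an
  -- interval with right end `w`.
  have hset : {v : ℝ | -1 ≤ v ∧ v * Real.exp v ≤ w * Real.exp w} = Set.Icc (-1) w := by
    ext v
    simp only [Set.mem_ofPred_eq, Set.mem_Icc]
    exact and_congr_right fun hv => hmono.le_iff_le hv hw
  rw [lambertW, hset, csSup_Icc hw]

/-- For `c = u log u - u` one has `c / e = (log u - 1) exp (log u - 1)`, so `W (c / e) = log u - 1`
and `u = c / W (c / e)`. The value `c = 0` belongs to `u = e`. Thus the Lambert quotient inverts the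
function that appears in the stationarity equation of an RT power. -/
lemma lambertRatio_mul_log_sub {u : ℝ} (hu : 1 ≤ u) : lambertRatio (u * Real.log u - u) = u := by
  have hu0 : 0 < u := by linarith
  have hlog : 0 ≤ Real.log u := Real.log_nonneg hu
  have hexp : Real.exp (Real.log u - 1) = u / Real.exp 1 := by
    rw [Real.exp_sub, Real.exp_log hu0]
  have hc : (u * Real.log u - u) / Real.exp 1 =
      (Real.log u - 1) * Real.exp (Real.log u - 1) := by
    rw [hexp]; ring
  rw [lambertRatio, hc, lambertW_mul_exp (by linarith)]
  split_ifs with h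
  · have h1 : u * (Real.log u - 1) = 0 := by linarith
    have h2 : Real.log u = 1 := by
      rcases mul_eq_zero.1 h1 with h1 | h1 <;> linarith
    rw [← Real.exp_log hu0, h2]
  · have : Real.log u - 1 ≠ 0 := fun h1 => h (by rw [← mul_sub_one, h1, mul_zero])
    field_simp

lemma strictMonoOn_mul_log_sub : StrictMonoOn (fun u : ℝ => u * Real.log u - u) (Set.Ici 1) := by
  refine strictMonoOn_of_deriv_pos (convex_Ici _) ?_ fun x hx => ?_
  · exact (Real.continuous_mul_log.sub continuous_id).continuousOn
  · rw [interior_Ici, Set.mem_Ioi] at hx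
    have h := (Real.hasDerivAt_mul_log (x := x) (by linarith)).sub (hasDerivAt_id x)
    have h' : HasDerivAt (fun u : ℝ => u * Real.log u - u) (Real.log x + 1 - 1) x := h
    rw [h'.deriv, add_sub_cancel_right]
    exact Real.log_pos hx

lemma exists_mul_log_sub_eq {c : ℝ} (hc : -1 ≤ c) : ∃ u : ℝ, 1 ≤ u ∧ u * Real.log u - u = c := by
  -- Since `log b ≥ 2`, the function is at least `b ≥ c` at `b`; at `1` it equals `-1 ≤ c`.
  set b : ℝ := max (Real.exp 2) c with hb
  have h2 : Real.exp 2 ≤ b := le_max_left _ _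
  have hb1 : 1 ≤ b := le_trans (Real.one_le_exp (by norm_num)) h2
  have hcont : ContinuousOn (fun u : ℝ => u * Real.log u - u) (Set.Icc 1 b) :=
    (Real.continuous_mul_log.sub continuous_id).continuousOn
  have hlog : 2 ≤ Real.log b := by
    rw [Real.le_log_iff_exp_le (by linarith)]; exact h2
  have hcb : c ≤ b := le_max_right _ _
  obtain ⟨u, hu, hu'⟩ := intermediate_value_Icc hb1 hcont
    (show c ∈ _ from ⟨by simpa using hc, by nlinarith⟩)
  exact ⟨u, hu.1, hu'⟩

/-- `lambertRatio`, extended to `(-∞, -1)` by its value at `-1`. -/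
def lamRatio (c : ℝ) : ℝ := lambertRatio (max c (-1))

lemma lamRatio_eq {c : ℝ} (hc : -1 ≤ c) : lamRatio c = lambertRatio c := by
  rw [lamRatio, max_eq_left hc]

lemma lamRatio_mul_log_sub {u : ℝ} (hu : 1 ≤ u) : lamRatio (u * Real.log u - u) = u := by
  rw [lamRatio_eq, lambertRatio_mul_log_sub hu]
  have := strictMonoOn_mul_log_sub.monotoneOn (Set.mem_Ici.2 le_rfl) (Set.mem_Ici.2 hu) hu
  simpa using this

lemma lamRatio_spec (c : ℝ) :
    1 ≤ lamRatio c ∧ lamRatio c * Real.log (lamRatio c) - lamRatio c = max c (-1) := by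
  obtain ⟨u, hu, h⟩ := exists_mul_log_sub_eq (le_max_right c (-1))
  have : lamRatio c = u := by
    rw [lamRatio, ← h, lambertRatio_mul_log_sub hu]
  rw [this]
  exact ⟨hu, h⟩

lemma one_le_lamRatio (c : ℝ) : 1 ≤ lamRatio c := (lamRatio_spec c).1

lemma lamRatio_mono : Monotone lamRatio := fun a b hab => by
  rw [← strictMonoOn_mul_log_sub.le_iff_le (one_le_lamRatio a) (one_le_lamRatio b)]
  simp only [(lamRatio_spec a).2, (lamRatio_spec b).2]
  exact max_le_max_right _ hab

lemma lamRatio_of_le {c : ℝ} (hc : c ≤ -1) : lamRatio c = 1 := by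
  have := lambertRatio_mul_log_sub le_rfl
  rw [lamRatio, max_eq_right hc]
  simpa using this

/-- A monotone surjection of `ℝ` is continuous. The function is constantly `1` on `(-∞, -1]`, so the
term `min (c + 1) 0`, which vanishes for `c ≥ -1`, is added to reach the values below `1` and
subtracted again at the end. -/
lemma continuous_lamRatio : Continuous lamRatio := by
  have hmono : Monotone fun c => lamRatio c + min (c + 1) 0 := fun a b hab =>
    add_le_add (lamRatio_mono hab) (min_le_min_right _ (by linarith))
  have hsurj : Function.Surjective fun c => lamRatio c + min (c + 1) 0 := fun y => by
    rcases le_total 1 y with hy | hy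
    · refine ⟨y * Real.log y - y, ?_⟩
      have := strictMonoOn_mul_log_sub.monotoneOn (Set.mem_Ici.2 le_rfl) (Set.mem_Ici.2 hy) hy
      simp only [lamRatio_mul_log_sub hy]
      rw [min_eq_right, add_zero]
      simp at this
      linarith
    · refine ⟨y - 2, ?_⟩
      simp only [lamRatio_of_le (show y - 2 ≤ -1 by linarith)]
      rw [min_eq_left (by linarith)]
      ring
  have h := hmono.continuous_of_surjective hsurj
  have h2 : Continuous fun c : ℝ => min (c + 1) 0 := by fun_prop
  exact (h.sub h2).congr fun c => add_sub_cancel_right _ _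

lemma tendsto_lamRatio : Tendsto lamRatio atTop atTop := by
  refine tendsto_atTop.2 fun b => ?_
  filter_upwards [eventually_ge_atTop (max b 1 * Real.log (max b 1) - max b 1)] with c hc
  have := lamRatio_mono hc
  rw [lamRatio_mul_log_sub (le_max_right _ _)] at this
  exact (le_max_left _ _).trans this

/-! ### Capacity -/

lemma capacity_nonneg {p g : ℝ} (hp : 0 ≤ p) (hg : 0 ≤ g) : 0 ≤ capacity p g :=
  Real.log_nonneg (by nlinarith [mul_nonneg hp hg])

lemma capacity_mono {p p' g g' : ℝ} (hp : 0 ≤ p) (hg : 0 ≤ g) (hpp : p ≤ p') (hgg : g ≤ g') :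
    capacity p g ≤ capacity p' g' := by
  have h1 : 0 ≤ p * g := mul_nonneg hp hg
  have h2 : p * g ≤ p' * g' := mul_le_mul hpp hgg hg (hp.trans hpp)
  exact Real.log_le_log (by linarith) (by linarith)

/-- The capacity lies below its tangent. -/
lemma capacity_le_tangent {p p' g : ℝ} (hp : 0 ≤ p) (hp' : 0 ≤ p') (hg : 0 ≤ g) :
    capacity p' g ≤ capacity p g + g * (p' - p) / (1 + p * g) := by
  have h1 : 0 < 1 + p * g := by nlinarith [mul_nonneg hp hg]
  have h2 : 0 < 1 + p' * g := by nlinarith [mul_nonneg hp' hg]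
  have h := Real.log_le_sub_one_of_pos (div_pos h2 h1)
  rw [Real.log_div h2.ne' h1.ne'] at h
  have : (1 + p' * g) / (1 + p * g) - 1 = g * (p' - p) / (1 + p * g) := by
    field_simp; ring
  rw [this] at h
  simp only [capacity]
  linarith

lemma pos_of_capacity_pos {p g : ℝ} (hp : 0 ≤ p) (hg : 0 ≤ g) (h : 0 < capacity p g) :
    0 < p ∧ 0 < g := by
  constructor
  · refine lt_of_le_of_ne hp fun h0 => ?_
    simp [capacity, ← h0] at h
  · refine lt_of_le_of_ne hg fun h0 => ?_
    simp [capacity, ← h0] at h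

namespace Model

variable {nR nN : ℕ} (M : Model nR nN)

/-! ### Water filling -/

lemma waterPower_mem (Q X g : ℝ) : 0 ≤ M.waterPower Q X g ∧ M.waterPower Q X g ≤ M.Pmax := by
  have := M.Pmax_pos
  rw [waterPower]
  split_ifs
  · exact ⟨le_rfl, this.le⟩
  · exact ⟨this.le, le_rfl⟩
  · exact ⟨le_min (le_max_right _ _) this.le, min_le_right _ _⟩

/-- `Q log (1 + p g) - X p / Ts` is concave in `p`, and the water-filling power is its stationary
point clipped to `[0, Pmax]`. The tangent of the capacity at that power reduces the claim to the
sign of the slope there. -/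
lemma le_psiN {Q X g p : ℝ} (hQ : 0 ≤ Q) (hX : 0 ≤ X) (hg : 0 ≤ g) (hp : 0 ≤ p)
    (hpM : p ≤ M.Pmax) : Q * capacity p g - X * p / M.Ts ≤ M.psiN Q X g := by
  have hT := M.Ts_pos
  rw [psiN]
  by_cases h0 : g = 0 ∨ Q = 0
  · have : 0 ≤ X * p / M.Ts := by positivity
    rw [waterPower, if_pos h0]
    rcases h0 with h0 | h0 <;> simp [h0, capacity] <;> linarith
  obtain ⟨hg0, hQ0⟩ := not_or.1 h0
  have hg' : 0 < g := lt_of_le_of_ne hg (Ne.symm hg0)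
  have hQ' : 0 < Q := lt_of_le_of_ne hQ (Ne.symm hQ0)
  by_cases hX0 : X = 0
  · rw [waterPower, if_neg h0, if_pos hX0]
    simp only [hX0, zero_mul, zero_div, sub_zero]
    exact mul_le_mul_of_nonneg_left (capacity_mono hp hg hpM le_rfl) hQ
  have hX' : 0 < X := lt_of_le_of_ne hX (Ne.symm hX0)
  have hw := M.waterPower_mem Q X g
  have hwdef : M.waterPower Q X g = min (max (M.Ts * Q / X - 1 / g) 0) M.Pmax := by
    rw [waterPower, if_neg h0, if_neg hX0]
  set w := M.waterPower Q X g
  have htan := mul_le_mul_of_nonneg_left (capacity_le_tangent hw.1 hp hg) hQ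
  have h1 : 0 < 1 + w * g := by nlinarith [mul_nonneg hw.1 hg]
  suffices h : Q * (g * (p - w) / (1 + w * g)) ≤ X / M.Ts * (p - w) by
    have e : X * p / M.Ts - X * w / M.Ts = X / M.Ts * (p - w) := by ring
    linarith
  have e : Q * (g * (p - w) / (1 + w * g)) = Q * g / (1 + w * g) * (p - w) := by ring
  rw [e]
  -- `key` and `key'` compare the slope of `Q log (1 + p g)` at `w` with the price `X / Ts`,
  -- according to the side of the unclipped stationary point on which `w` lies. A bound that clips
  -- `w` leaves only one direction for `p`.
  have key : w ≤ M.Ts * Q / X - 1 / g → X / M.Ts ≤ Q * g / (1 + w * g) := fun h => by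
    rw [div_le_div_iff₀ hT h1]
    have h3 : X * g * w ≤ X * g * (M.Ts * Q / X - 1 / g) :=
      mul_le_mul_of_nonneg_left h (by positivity)
    have h4 : X * g * (M.Ts * Q / X - 1 / g) = g * M.Ts * Q - X := by field_simp
    nlinarith
  have key' : M.Ts * Q / X - 1 / g ≤ w → Q * g / (1 + w * g) ≤ X / M.Ts := fun h => by
    rw [div_le_div_iff₀ h1 hT]
    have h3 : X * g * (M.Ts * Q / X - 1 / g) ≤ X * g * w :=
      mul_le_mul_of_nonneg_left h (by positivity)
    have h4 : X * g * (M.Ts * Q / X - 1 / g) = g * M.Ts * Q - X := by field_simp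
    nlinarith
  rcases le_total p w with hpw | hpw
  · rcases eq_or_lt_of_le hw.1 with hw0 | hw0
    · have : p = w := le_antisymm hpw (hw0 ▸ hp)
      simp [this]
    · refine mul_le_mul_of_nonpos_right (key ?_) (by linarith)
      have h5 : w ≤ max (M.Ts * Q / X - 1 / g) 0 := hwdef ▸ min_le_left _ _
      rcases le_max_iff.1 h5 with h5 | h5
      · exact h5
      · linarith
  · rcases eq_or_lt_of_le hw.2 with hw0 | hw0
    · have : p = w := le_antisymm (hw0 ▸ hpM) hpw
      simp [this]
    · refine mul_le_mul_of_nonneg_right (key' ?_) (by linarith)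
      rw [hwdef] at hw0 ⊢
      rw [min_eq_left ((min_lt_iff.1 hw0).resolve_right (lt_irrefl _)).le]
      exact le_max_left _ _

lemma psiN_nonneg {Q X g : ℝ} (hQ : 0 ≤ Q) (hX : 0 ≤ X) (hg : 0 ≤ g) : 0 ≤ M.psiN Q X g := by
  simpa [capacity] using M.le_psiN hQ hX hg le_rfl M.Pmax_pos.le

/-! ### Lambert powers -/

/-- `lambertPower` with the total function `lamRatio`. -/
def rtPower (X ψ φ g : ℝ) : ℝ :=
  if X = 0 then M.Pmax
  else min (1 / g * (lamRatio ((ψ + φ) * M.Ts / X * g - 1) - 1)) M.Pmax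

/-- For nonnegative queues, values and gains the argument of the Lambert quotient is at least `-1`,
where the total extension agrees with it. -/
lemma lambertPower_eq {X ψ φ g : ℝ} (hX : 0 ≤ X) (hψ : 0 ≤ ψ) (hφ : 0 ≤ φ) (hg : 0 ≤ g) :
    M.lambertPower X ψ φ g = M.rtPower X ψ φ g := by
  have := M.Ts_pos
  have h : 0 ≤ (ψ + φ) * M.Ts / X * g := by positivity
  rw [lambertPower, rtPower, lamRatio_eq (by linarith)]

lemma rtPower_nonneg {X ψ φ g : ℝ} (hg : 0 ≤ g) : 0 ≤ M.rtPower X ψ φ g := by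
  rw [rtPower]
  split_ifs
  · exact M.Pmax_pos.le
  · have := one_le_lamRatio ((ψ + φ) * M.Ts / X * g - 1)
    exact le_min (mul_nonneg (by positivity) (by linarith)) M.Pmax_pos.le

lemma rtPower_le (X ψ φ g : ℝ) : M.rtPower X ψ φ g ≤ M.Pmax := by
  rw [rtPower]
  split_ifs
  · exact le_rfl
  · exact min_le_right _ _

lemma rtPower_mono {X ψ φ φ' g : ℝ} (hX : 0 ≤ X) (hg : 0 ≤ g) (h : φ ≤ φ') :
    M.rtPower X ψ φ g ≤ M.rtPower X ψ φ' g := by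
  rw [rtPower, rtPower]
  split_ifs
  · exact le_rfl
  · refine min_le_min_right _ (mul_le_mul_of_nonneg_left ?_ (by positivity))
    have := M.Ts_pos
    refine sub_le_sub_right (lamRatio_mono (sub_le_sub_right ?_ _)) _
    gcongr

lemma continuous_rtPower (X ψ g : ℝ) : Continuous fun φ => M.rtPower X ψ φ g := by
  simp only [rtPower]
  split_ifs
  · exact continuous_const
  · have := continuous_lamRatio
    fun_prop

lemma eventually_rtPower_eq {X ψ g : ℝ} (hX : 0 ≤ X) (hg : 0 < g) :
    ∀ᶠ φ in atTop, M.rtPower X ψ φ g = M.Pmax := by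
  rcases eq_or_lt_of_le hX with h0 | h0
  · exact Eventually.of_forall fun φ => by rw [rtPower, if_pos h0.symm]
  have hT := M.Ts_pos
  have h1 : Tendsto (fun φ : ℝ => (ψ + φ) * M.Ts / X * g - 1) atTop atTop := by
    refine tendsto_atTop_add_const_right _ _ ?_
    refine Tendsto.atTop_mul_const hg (Tendsto.atTop_div_const h0 (Tendsto.atTop_mul_const hT ?_))
    exact tendsto_atTop_add_const_left _ _ tendsto_id
  filter_upwards [(tendsto_lamRatio.comp h1).eventually_ge_atTop (1 + M.Pmax * g)] with φ hφ
  rw [rtPower, if_neg h0.ne', min_eq_right]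
  simp only [Function.comp] at hφ
  rw [one_div, ← div_eq_inv_mul, le_div_iff₀ hg]
  linarith

/-- The Lambert power minimises the cost of a packet of an RT user. -/
lemma rtPower_opt {X ψ φ g p : ℝ} (hX : 0 ≤ X) (hψ : 0 ≤ ψ) (hφ : 0 ≤ φ) (hg : 0 < g)
    (hp : 0 ≤ p) (hpM : p ≤ M.Pmax) :
    (X / M.Ts * M.rtPower X ψ φ g + (ψ + φ)) * capacity p g ≤
      (X / M.Ts * p + (ψ + φ)) * capacity (M.rtPower X ψ φ g) g := by
  have hT := M.Ts_pos
  have hw0 := M.rtPower_nonneg (X := X) (ψ := ψ) (φ := φ) hg.le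
  rcases eq_or_lt_of_le hX with h0 | h0
  · rw [rtPower, if_pos h0.symm, ← h0]
    simp only [zero_div, zero_mul, zero_add]
    exact mul_le_mul_of_nonneg_left (capacity_mono hp hg.le hpM le_rfl) (by positivity)
  have hdef : M.rtPower X ψ φ g =
      min (1 / g * (lamRatio ((ψ + φ) * M.Ts / X * g - 1) - 1)) M.Pmax := by
    rw [rtPower, if_neg h0.ne']
  have hspec := lamRatio_spec ((ψ + φ) * M.Ts / X * g - 1)
  have hc : 0 ≤ (ψ + φ) * M.Ts / X * g := by positivity
  rw [max_eq_left (by linarith)] at hspec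
  set u := lamRatio ((ψ + φ) * M.Ts / X * g - 1)
  set w := M.rtPower X ψ φ g
  have h1 : 1 ≤ 1 + w * g := by nlinarith [mul_nonneg hw0 hg.le]
  have htan := capacity_le_tangent hw0 hp hg.le
  -- the derivative has the right sign
  have hwu : 1 + w * g ≤ u := by
    have : w ≤ 1 / g * (u - 1) := hdef ▸ min_le_left _ _
    rw [one_div, ← div_eq_inv_mul, le_div_iff₀ hg] at this
    linarith
  have hA : (1 + w * g) * capacity w g - (1 + w * g) ≤ (ψ + φ) * M.Ts / X * g - 1 := by
    rw [← hspec.2]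
    exact strictMonoOn_mul_log_sub.monotoneOn (Set.mem_Ici.2 h1) (Set.mem_Ici.2 hspec.1) hwu
  have hB : w < M.Pmax → (1 + w * g) * capacity w g - (1 + w * g) =
      (ψ + φ) * M.Ts / X * g - 1 := fun h => by
    rw [← hspec.2]
    have : w = 1 / g * (u - 1) := by
      rw [hdef] at h ⊢
      exact min_eq_left ((min_lt_iff.1 h).resolve_right (lt_irrefl _)).le
    have : 1 + w * g = u := by rw [this]; field_simp; ring
    rw [capacity, this]
  have hx : 0 < X / M.Ts := by positivity
  have hcx : (ψ + φ) * M.Ts / X * g = (ψ + φ) * g / (X / M.Ts) := by field_simp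
  rw [hcx] at hA hB
  set x := X / M.Ts
  set c := ψ + φ
  have hc0 : 0 ≤ c := add_nonneg hψ hφ
  -- Up to a positive factor, this says that the cost per bit `(x p + c) / log (1 + p g)` has
  -- nonpositive derivative at `p = w`. When `w < Pmax`, `hB` makes it an equality.
  have hA' : x * ((1 + w * g) * capacity w g) ≤ (x * w + c) * g := by
    have : x * (c * g / x) = c * g := by field_simp
    nlinarith [mul_le_mul_of_nonneg_left hA hx.le]
  -- Adding `(x w + c) capacity w g` to both sides turns the left side into the tangent bound for
  -- `(x w + c) capacity p g` and the right side into `(x p + c) capacity w g`. For `p < w` the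
  -- derivative sign suffices; for `p > w` the cap is not active and equality holds.
  have hsign : (x * w + c) * (g * (p - w) / (1 + w * g)) ≤ x * capacity w g * (p - w) := by
    have e : (x * w + c) * (g * (p - w) / (1 + w * g)) =
      (x * w + c) * g / (1 + w * g) * (p - w) := by ring
    rw [e]
    rcases le_total p w with hpw | hpw
    · refine mul_le_mul_of_nonpos_right ?_ (by linarith)
      rw [le_div_iff₀ (by linarith)]
      linarith
    · rcases eq_or_lt_of_le (M.rtPower_le X ψ φ g) with h | h
      · have : p = w := le_antisymm (hpM.trans h.ge) hpw
        simp [this]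
      · refine mul_le_mul_of_nonneg_right ?_ (by linarith)
        rw [div_le_iff₀ (by linarith)]
        have : x * (c * g / x) = c * g := by field_simp
        have hB' : x * _ = x * _ := congrArg (x * ·) (hB h)
        linarith
  have := mul_le_mul_of_nonneg_left htan (show 0 ≤ x * w + c by positivity)
  linarith

/-! ### The powers for a given set of RT users -/

/-- Powers at which the RT users in `S` can be served within one slot. -/
def FeasiblePowers (g : Fin nR → ℝ) (S : Finset (Fin nR)) (p : Fin nR → ℝ) : Prop :=
  (∀ i ∈ S, 0 ≤ p i ∧ p i ≤ M.Pmax ∧ 0 < capacity (p i) (g i)) ∧ M.rtTime g p S ≤ M.Ts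

/-- The multiplier `φ` leads to powers at which `S` can be served within one slot. -/
def MultiplierOK (X ψ : ℝ) (g : Fin nR → ℝ) (S : Finset (Fin nR)) (φ : ℝ) : Prop :=
  (∀ i ∈ S, 0 < capacity (M.rtPower X ψ φ (g i)) (g i)) ∧
    M.rtTime g (fun i => M.rtPower X ψ φ (g i)) S ≤ M.Ts

/-- Each RT user in `S` pays for its energy at price `X / Ts` and for the time it takes from NRT
data at price `ψ`. In this form the slot-length constraint is dualised by replacing `ψ` with `ψ +
φ`. -/
lemma setValue_eq (X ψ : ℝ) (Y g : Fin nR → ℝ) (S : Finset (Fin nR)) (p : Fin nR → ℝ) :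
    M.setValue X ψ Y g S p = ∑ i ∈ S, Y i + ψ * M.Ts -
      ∑ i ∈ S, M.L / capacity (p i) (g i) * (X / M.Ts * p i + ψ) := by
  rw [setValue, rtTime, mul_sub, Finset.mul_sum, Finset.sum_sub_distrib]
  have : ∑ i ∈ S, M.L / capacity (p i) (g i) * (X / M.Ts * p i + ψ) =
      ∑ i ∈ S, M.L / (M.Ts * capacity (p i) (g i)) * X * p i +
        ∑ i ∈ S, ψ * (M.L / capacity (p i) (g i)) := by
    rw [← Finset.sum_add_distrib]
    refine Finset.sum_congr rfl fun i _ => ?_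
    rw [div_mul_eq_div_div]
    ring
  rw [this]
  ring

variable {M} in
lemma IsSearchResult.feasible {X ψ : ℝ} {g : Fin nR → ℝ} {S : Finset (Fin nR)} {p : Fin nR → ℝ}
    (hX : 0 ≤ X) (hψ : 0 ≤ ψ) (hg : ∀ i, 0 ≤ g i) (h : M.IsSearchResult X ψ g S p) :
    M.FeasiblePowers g S p := by
  obtain ⟨φ, hφ, hp, hT, -⟩ := h
  refine ⟨fun i hi => ?_, hT⟩
  have hpi := (hp i hi).1
  rw [M.lambertPower_eq hX hψ hφ (hg i)] at hpi
  exact ⟨hpi ▸ M.rtPower_nonneg (hg i), hpi ▸ M.rtPower_le _ _ _ _, (hp i hi).2⟩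

variable {M} in
-- Weak duality: at time price `ψ + φ` the Lambert powers minimise the cost user by user. Passing
-- back to the price `ψ` changes the costs by `φ` times the RT time, which equals `φ Ts` for the
-- search result by complementary slackness and is at most `φ Ts` for the competitor.
lemma IsSearchResult.setValue_le {X ψ : ℝ} {Y g : Fin nR → ℝ} {S : Finset (Fin nR)}
    {p p' : Fin nR → ℝ} (hX : 0 ≤ X) (hψ : 0 ≤ ψ) (hg : ∀ i, 0 ≤ g i)
    (h : M.IsSearchResult X ψ g S p) (h' : M.FeasiblePowers g S p') :
    M.setValue X ψ Y g S p' ≤ M.setValue X ψ Y g S p := by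
  have hf := h.feasible hX hψ hg
  obtain ⟨φ, hφ, hp, hT, hcomp⟩ := h
  have hL := M.L_pos
  rw [setValue_eq, setValue_eq]
  have hterm : ∀ i ∈ S, M.L / capacity (p i) (g i) * (X / M.Ts * p i + (ψ + φ)) ≤
      M.L / capacity (p' i) (g i) * (X / M.Ts * p' i + (ψ + φ)) := fun i hi => by
    obtain ⟨h1, h2, h3⟩ := h'.1 i hi
    obtain ⟨h4, h5, h6⟩ := hf.1 i hi
    have hopt := M.rtPower_opt hX hψ hφ (pos_of_capacity_pos h1 (hg i) h3).2 h1 h2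
    rw [← M.lambertPower_eq hX hψ hφ (hg i), ← (hp i hi).1] at hopt
    rw [div_mul_eq_mul_div M.L, div_mul_eq_mul_div M.L, div_le_div_iff₀ h6 h3, mul_assoc, mul_assoc]
    exact mul_le_mul_of_nonneg_left hopt hL.le
  have hsum := Finset.sum_le_sum hterm
  have hsplit : ∀ r : Fin nR → ℝ,
      ∑ i ∈ S, M.L / capacity (r i) (g i) * (X / M.Ts * r i + (ψ + φ)) =
      ∑ i ∈ S, M.L / capacity (r i) (g i) * (X / M.Ts * r i + ψ) + φ * M.rtTime g r S :=
    fun r => by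
      rw [rtTime, Finset.mul_sum, ← Finset.sum_add_distrib]
      exact Finset.sum_congr rfl fun i _ => by ring
  rw [hsplit, hsplit] at hsum
  have := mul_le_mul_of_nonneg_left h'.2 hφ
  linarith

lemma continuous_capacity_rtPower (X ψ : ℝ) {g : ℝ} (hg : 0 ≤ g) :
    Continuous fun φ => capacity (M.rtPower X ψ φ g) g := by
  refine Continuous.log ((M.continuous_rtPower X ψ g).mul_const g |>.const_add 1) fun φ => ?_
  have := mul_nonneg (M.rtPower_nonneg (X := X) (ψ := ψ) (φ := φ) hg) hg
  positivity

variable {M} in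
lemma MultiplierOK.mono {X ψ φ φ' : ℝ} {g : Fin nR → ℝ} {S : Finset (Fin nR)}
    (hX : 0 ≤ X) (hg : ∀ i, 0 ≤ g i) (hle : φ ≤ φ') (h : M.MultiplierOK X ψ g S φ) :
    M.MultiplierOK X ψ g S φ' := by
  have hcap : ∀ i, capacity (M.rtPower X ψ φ (g i)) (g i) ≤
      capacity (M.rtPower X ψ φ' (g i)) (g i) := fun i =>
    capacity_mono (M.rtPower_nonneg (hg i)) (hg i) (M.rtPower_mono hX (hg i) hle) le_rfl
  refine ⟨fun i hi => (h.1 i hi).trans_le (hcap i), le_trans (Finset.sum_le_sum fun i hi => ?_) h.2⟩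
  exact div_le_div_of_nonneg_left M.L_pos.le (h.1 i hi) (hcap i)

variable {M} in
-- For large `φ` every user in `S` transmits at `Pmax`, which is at least as fast as the given
-- powers.
lemma FeasiblePowers.exists_multiplierOK {X : ℝ} (ψ : ℝ) {g : Fin nR → ℝ} {S : Finset (Fin nR)}
    {p : Fin nR → ℝ} (hX : 0 ≤ X) (hg : ∀ i, 0 ≤ g i) (h : M.FeasiblePowers g S p) :
    ∃ φ, 0 ≤ φ ∧ M.MultiplierOK X ψ g S φ := by
  have hev : ∀ᶠ φ in atTop, ∀ i ∈ S, M.rtPower X ψ φ (g i) = M.Pmax :=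
    (Finset.eventually_all S).2 fun i hi =>
      M.eventually_rtPower_eq hX (pos_of_capacity_pos (h.1 i hi).1 (hg i) (h.1 i hi).2.2).2
  obtain ⟨φ, hφ, hφ0⟩ := (hev.and (eventually_ge_atTop 0)).exists
  have hcap : ∀ i ∈ S, capacity (p i) (g i) ≤ capacity (M.rtPower X ψ φ (g i)) (g i) :=
    fun i hi => by
      rw [hφ i hi]
      exact capacity_mono (h.1 i hi).1 (hg i) (h.1 i hi).2.1 le_rfl
  refine ⟨φ, hφ0, fun i hi => (h.1 i hi).2.2.trans_le (hcap i hi),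
    le_trans (Finset.sum_le_sum fun i hi => ?_) h.2⟩
  exact div_le_div_of_nonneg_left M.L_pos.le (h.1 i hi).2.2 (hcap i hi)

lemma exists_isLeast_multiplier {X ψ : ℝ} {g : Fin nR → ℝ} {S : Finset (Fin nR)}
    (hg : ∀ i, 0 ≤ g i) (h : ∃ φ, 0 ≤ φ ∧ M.MultiplierOK X ψ g S φ) :
    ∃ φ, IsLeast {φ | 0 ≤ φ ∧ M.MultiplierOK X ψ g S φ} φ := by
  have hL := M.L_pos
  have hT := M.Ts_pos
  -- A set that fits into the slot needs rate at least `L / Ts` for each user. Restricting to this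
  -- closed set keeps the rates away from zero, where `L / 0 = 0` would make the RT time
  -- discontinuous.
  set C : Set ℝ := {φ | 0 ≤ φ ∧ ∀ i ∈ S, M.L / M.Ts ≤ capacity (M.rtPower X ψ φ (g i)) (g i)}
    with hC
  have hCclosed : IsClosed C := by
    have : C = Set.Ici 0 ∩ ⋂ i ∈ S,
        {φ | M.L / M.Ts ≤ capacity (M.rtPower X ψ φ (g i)) (g i)} := by
      ext φ; simp [hC]
    rw [this]
    exact isClosed_Ici.inter (isClosed_biInter fun i _ =>
      isClosed_le continuous_const (M.continuous_capacity_rtPower X ψ (hg i)))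
  have hcont : ContinuousOn (fun φ => M.rtTime g (fun i => M.rtPower X ψ φ (g i)) S) C := by
    refine continuousOn_finsetSum _ fun i hi => ?_
    refine continuousOn_const.div (M.continuous_capacity_rtPower X ψ (hg i)).continuousOn
      fun φ hφ => ?_
    have := hφ.2 i hi
    have : 0 < M.L / M.Ts := by positivity
    linarith
  have heq : {φ | 0 ≤ φ ∧ M.MultiplierOK X ψ g S φ} =
      C ∩ (fun φ => M.rtTime g (fun i => M.rtPower X ψ φ (g i)) S) ⁻¹' Set.Iic M.Ts := by
    ext φ
    constructor
    · rintro ⟨h0, h1, h2⟩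
      refine ⟨⟨h0, fun i hi => ?_⟩, h2⟩
      have h3 : M.L / capacity (M.rtPower X ψ φ (g i)) (g i) ≤ M.Ts :=
        le_trans (Finset.single_le_sum
          (f := fun i => M.L / capacity (M.rtPower X ψ φ (g i)) (g i))
          (fun j hj => div_nonneg hL.le (h1 j hj).le) hi) h2
      rw [div_le_iff₀ (h1 i hi)] at h3
      rw [div_le_iff₀ hT]
      linarith
    · rintro ⟨⟨h0, h1⟩, h2⟩
      exact ⟨h0, fun i hi => lt_of_lt_of_le (by positivity) (h1 i hi), h2⟩
  have hclosed : IsClosed {φ | 0 ≤ φ ∧ M.MultiplierOK X ψ g S φ} := by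
    rw [heq]
    exact hcont.preimage_isClosed_of_isClosed hCclosed isClosed_Iic
  exact ⟨_, hclosed.isLeast_csInf h ⟨0, fun φ hφ => hφ.1⟩⟩

/-- Complementary slackness comes from minimality: if `φ > 0` and time were left over, a slightly
smaller multiplier would still serve `S`, by continuity of rates and times. -/
lemma isSearchResult_of_isLeast {X ψ φ : ℝ} {g : Fin nR → ℝ} {S : Finset (Fin nR)}
    (hX : 0 ≤ X) (hψ : 0 ≤ ψ) (hg : ∀ i, 0 ≤ g i)
    (h : IsLeast {φ | 0 ≤ φ ∧ M.MultiplierOK X ψ g S φ} φ) :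
    M.IsSearchResult X ψ g S fun i => M.rtPower X ψ φ (g i) := by
  obtain ⟨⟨h0, h1, h2⟩, hmin⟩ := h
  refine ⟨φ, h0, fun i hi => ⟨(M.lambertPower_eq hX hψ h0 (hg i)).symm, h1 i hi⟩, h2, ?_⟩
  rcases eq_or_lt_of_le h0 with h0 | h0
  · rw [← h0, zero_mul]
  rcases eq_or_lt_of_le h2 with h2 | h2
  · rw [h2, sub_self, mul_zero]
  exfalso
  have hev1 : ∀ᶠ φ' in nhds φ, ∀ i ∈ S, 0 < capacity (M.rtPower X ψ φ' (g i)) (g i) :=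
    (Finset.eventually_all S).2 fun i hi =>
      (M.continuous_capacity_rtPower X ψ (hg i)).continuousAt.eventually_const_lt (h1 i hi)
  have hct : ContinuousAt (fun φ => M.rtTime g (fun i => M.rtPower X ψ φ (g i)) S) φ :=
    tendsto_finsetSum _ fun i hi => tendsto_const_nhds.div
      (M.continuous_capacity_rtPower X ψ (hg i)).continuousAt (h1 i hi).ne'
  have hev2 := hct.eventually_lt_const h2
  have hev3 : ∀ᶠ φ' in nhdsWithin φ (Set.Iio φ), φ' < φ := self_mem_nhdsWithin
  obtain ⟨φ', ⟨⟨h3, h4⟩, h5⟩, h6⟩ :=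
    (((hev1.and hev2).and (eventually_gt_nhds h0)).filter_mono nhdsWithin_le_nhds |>.and hev3).exists
  exact absurd (hmin ⟨h5.le, h3, h4.le⟩) (not_le.2 h6)

variable {M} in
lemma FeasiblePowers.exists_isSearchResult {X ψ : ℝ} {g : Fin nR → ℝ} {S : Finset (Fin nR)}
    {p : Fin nR → ℝ} (hX : 0 ≤ X) (hψ : 0 ≤ ψ) (hg : ∀ i, 0 ≤ g i)
    (h : M.FeasiblePowers g S p) : ∃ p', M.IsSearchResult X ψ g S p' := by
  obtain ⟨φ, hφ⟩ := M.exists_isLeast_multiplier hg (h.exists_multiplierOK ψ hX hg)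
  exact ⟨_, M.isSearchResult_of_isLeast hX hψ hg hφ⟩

/-! ### Discarded sets are not optimal -/

/-- Exchange argument: replace `j` by `i` and choose the power of `i` so that the received power `p
g` is unchanged. Rate and time stay the same, the power does not grow because `g j < g i`, and `Y j`
is replaced by the strictly larger `Y i`. -/
lemma Discarded.exists_lt {X ψ : ℝ} {Y g : Fin nR → ℝ} {S : Finset (Fin nR)} {p : Fin nR → ℝ}
    (hX : 0 ≤ X) (hg : ∀ i, 0 ≤ g i) (hd : Discarded Y g S) (h : M.FeasiblePowers g S p) :
    ∃ S' p', M.FeasiblePowers g S' p' ∧ M.setValue X ψ Y g S p < M.setValue X ψ Y g S' p' := by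
  obtain ⟨i, hi, j, hj, hY, hgij⟩ := hd
  obtain ⟨hj0, hjM, hjc⟩ := h.1 j hj
  have hgi : 0 < g i := (hg j).trans_lt hgij
  have hL := M.L_pos
  have hT := M.Ts_pos
  set r : ℝ := p j * g j / g i with hr
  have hr0 : 0 ≤ r := div_nonneg (mul_nonneg hj0 (hg j)) hgi.le
  have hrj : r ≤ p j := by
    rw [hr, div_le_iff₀ hgi]
    exact mul_le_mul_of_nonneg_left hgij.le hj0
  have hcap : capacity r (g i) = capacity (p j) (g j) := by
    rw [capacity, capacity, hr, div_mul_cancel₀ _ hgi.ne']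
  set T := S.erase j with hTdef
  have hST : S = insert j T := (Finset.insert_erase hj).symm
  have hjT : j ∉ T := Finset.notMem_erase j S
  have hiT : i ∉ T := fun h' => hi (Finset.mem_of_mem_erase h')
  set p' : Fin nR → ℝ := Function.update p i r with hp'
  have hp'i : p' i = r := Function.update_self _ _ _
  have hp'k : ∀ k ∈ T, p' k = p k := fun k hk =>
    Function.update_of_ne (by rintro rfl; exact hiT hk) _ _
  have htime : M.rtTime g p' (insert i T) = M.rtTime g p S := by
    rw [hST, rtTime, rtTime, Finset.sum_insert hiT, Finset.sum_insert hjT, hp'i, hcap]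
    congr 1
    exact Finset.sum_congr rfl fun k hk => by rw [hp'k k hk]
  refine ⟨insert i T, p', ⟨fun k hk => ?_, htime ▸ h.2⟩, ?_⟩
  · rcases Finset.mem_insert.1 hk with rfl | hk
    · rw [hp'i, hcap]
      exact ⟨hr0, hrj.trans hjM, hjc⟩
    · rw [hp'k k hk]
      exact h.1 k (hST ▸ Finset.mem_insert_of_mem hk)
  · have hsum : ∑ k ∈ T, (Y k - M.L / (M.Ts * capacity (p' k) (g k)) * X * p' k) =
        ∑ k ∈ T, (Y k - M.L / (M.Ts * capacity (p k) (g k)) * X * p k) :=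
      Finset.sum_congr rfl fun k hk => by rw [hp'k k hk]
    rw [setValue, setValue, htime, hST, Finset.sum_insert hiT, Finset.sum_insert hjT, hsum, hp'i,
      hcap]
    have : M.L / (M.Ts * capacity (p j) (g j)) * X * r ≤
        M.L / (M.Ts * capacity (p j) (g j)) * X * p j :=
      mul_le_mul_of_nonneg_left hrj (by positivity)
    linarith

/-- A set that is best among the sets that are not discarded is best among all sets. -/
lemma setValue_le_of_best {X ψ : ℝ} {Y g : Fin nR → ℝ} {S : Finset (Fin nR)} {p : Fin nR → ℝ}
    (hX : 0 ≤ X) (hψ : 0 ≤ ψ) (hg : ∀ i, 0 ≤ g i)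
    (hbest : ∀ S' p', ¬ Discarded Y g S' → M.IsSearchResult X ψ g S' p' →
      M.setValue X ψ Y g S' p' ≤ M.setValue X ψ Y g S p)
    {S' : Finset (Fin nR)} {p' : Fin nR → ℝ} (h' : M.FeasiblePowers g S' p') :
    M.setValue X ψ Y g S' p' ≤ M.setValue X ψ Y g S p := by
  classical
  have hsearch : ∀ S'', ∃ p'', (∃ p, M.FeasiblePowers g S'' p) → M.IsSearchResult X ψ g S'' p'' :=
    fun S'' => by
      by_cases h : ∃ p, M.FeasiblePowers g S'' p
      · obtain ⟨p, hp⟩ := h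
        obtain ⟨p'', hp''⟩ := hp.exists_isSearchResult (ψ := ψ) hX hψ hg
        exact ⟨p'', fun _ => hp''⟩
      · exact ⟨0, fun h' => absurd h' h⟩
  choose r hr using hsearch
  -- `T` is best among all servable sets, discarded ones included, each with its search powers. It
  -- cannot be discarded, since the exchange would produce a strictly better set; so the assumed
  -- optimality of `S` applies to `T`.
  obtain ⟨T, hT, hmax⟩ := Finset.exists_max_image
    (Finset.univ.filter fun S'' : Finset (Fin nR) => ∃ p, M.FeasiblePowers g S'' p)
    (fun S'' => M.setValue X ψ Y g S'' (r S'')) ⟨S', by simpa using ⟨p', h'⟩⟩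
  have hTf : ∃ p, M.FeasiblePowers g T p := by simpa using hT
  have hTr := hr T hTf
  have hnd : ¬ Discarded Y g T := fun hd => by
    obtain ⟨S₂, p₂, hf, hlt⟩ := hd.exists_lt M hX hg (hTr.feasible hX hψ hg) (ψ := ψ)
    have h1 := (hr S₂ ⟨p₂, hf⟩).setValue_le (Y := Y) hX hψ hg hf
    have h2 := hmax S₂ (by simpa using ⟨p₂, hf⟩)
    linarith
  exact ((hr S' ⟨p', h'⟩).setValue_le hX hψ hg h').trans
    ((hmax S' (by simpa using ⟨p', h'⟩)).trans (hbest T _ hnd hTr))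

/-! ### The per-slot problem -/

/-- Powers and durations satisfying the per-slot constraints. -/
structure Admissible (g dur pow : User nR nN → ℝ) : Prop where
  pow_mem : ∀ u, 0 ≤ pow u ∧ pow u ≤ M.Pmax
  dur_nonneg : ∀ u, 0 ≤ dur u
  dur_sum : ∑ u, dur u = M.Ts
  rt_packet : ∀ i, dur (Sum.inl i) = 0 ∨ (0 < capacity (pow (Sum.inl i)) (g (Sum.inl i)) ∧
    dur (Sum.inl i) = M.L / capacity (pow (Sum.inl i)) (g (Sum.inl i)))

/-- The objective of the per-slot problem. -/
def slotObj (Y : Fin nR → ℝ) (Q : Fin nN → ℝ) (X : ℝ) (g dur pow : User nR nN → ℝ) : ℝ :=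
  ∑ i, Y i * (if dur (Sum.inl i) = 0 then 0 else 1) +
    ∑ j, Q j * (dur (Sum.inr j) * capacity (pow (Sum.inr j)) (g (Sum.inr j))) -
    X * ((∑ u, pow u * dur u) / M.Ts)

lemma slotObj_eq (Y : Fin nR → ℝ) (Q : Fin nN → ℝ) (X : ℝ) (g dur pow : User nR nN → ℝ) :
    M.slotObj Y Q X g dur pow =
      ∑ i, (Y i * (if dur (Sum.inl i) = 0 then 0 else 1) -
        X / M.Ts * pow (Sum.inl i) * dur (Sum.inl i)) +
      ∑ j, dur (Sum.inr j) * (Q j * capacity (pow (Sum.inr j)) (g (Sum.inr j)) -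
        X * pow (Sum.inr j) / M.Ts) := by
  have h1 : X * ((∑ u, pow u * dur u) / M.Ts) =
      ∑ i, X / M.Ts * pow (Sum.inl i) * dur (Sum.inl i) +
        ∑ j, X / M.Ts * pow (Sum.inr j) * dur (Sum.inr j) := by
    rw [Fintype.sum_sum_type, ← mul_div_assoc, mul_add, add_div, Finset.mul_sum, Finset.mul_sum,
      Finset.sum_div, Finset.sum_div]
    congr 1 <;> exact Finset.sum_congr rfl fun _ _ => by ring
  have h2 : ∑ j, dur (Sum.inr j) * (Q j * capacity (pow (Sum.inr j)) (g (Sum.inr j)) -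
        X * pow (Sum.inr j) / M.Ts) =
      ∑ j, Q j * (dur (Sum.inr j) * capacity (pow (Sum.inr j)) (g (Sum.inr j))) -
        ∑ j, X / M.Ts * pow (Sum.inr j) * dur (Sum.inr j) := by
    rw [← Finset.sum_sub_distrib]
    exact Finset.sum_congr rfl fun _ _ => by ring
  rw [slotObj, h1, h2, Finset.sum_sub_distrib]
  ring

variable {M}

lemma Admissible.feasiblePowers {g dur pow : User nR nN → ℝ} (h : M.Admissible g dur pow)
    (S : Finset (Fin nR)) (hS : ∀ i, i ∈ S ↔ dur (Sum.inl i) ≠ 0) :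
    M.FeasiblePowers (fun i => g (Sum.inl i)) S (fun i => pow (Sum.inl i)) ∧
      M.rtTime (fun i => g (Sum.inl i)) (fun i => pow (Sum.inl i)) S =
        ∑ i, dur (Sum.inl i) := by
  have htime : M.rtTime (fun i => g (Sum.inl i)) (fun i => pow (Sum.inl i)) S =
      ∑ i, dur (Sum.inl i) := by
    rw [rtTime, ← Finset.sum_subset (Finset.subset_univ S)
      fun i _ hi => not_not.1 (mt (hS i).2 hi)]
    exact Finset.sum_congr rfl fun i hi => ((h.rt_packet i).resolve_left ((hS i).1 hi)).2.symm
  refine ⟨⟨fun i hi => ⟨(h.pow_mem _).1, (h.pow_mem _).2,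
    ((h.rt_packet i).resolve_left ((hS i).1 hi)).1⟩, ?_⟩, htime⟩
  rw [htime, ← h.dur_sum, Fintype.sum_sum_type]
  exact le_add_of_nonneg_right (Finset.sum_nonneg fun j _ => h.dur_nonneg _)

/-- The RT parts agree term by term. The NRT users share the remaining time, and each earns at most
`ψ` per unit of it, whatever its power. -/
lemma Admissible.slotObj_le {g dur pow : User nR nN → ℝ} (h : M.Admissible g dur pow)
    {Y : Fin nR → ℝ} {Q : Fin nN → ℝ} {X ψ : ℝ} (hQ : ∀ j, 0 ≤ Q j) (hX : 0 ≤ X)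
    (hg : ∀ u, 0 ≤ g u) (hψ : ∀ j, M.psiN (Q j) X (g (Sum.inr j)) ≤ ψ)
    (S : Finset (Fin nR)) (hS : ∀ i, i ∈ S ↔ dur (Sum.inl i) ≠ 0) :
    M.slotObj Y Q X g dur pow ≤
      M.setValue X ψ Y (fun i => g (Sum.inl i)) S (fun i => pow (Sum.inl i)) := by
  have hT := M.Ts_pos
  rw [slotObj_eq, setValue, (h.feasiblePowers S hS).2]
  have hsum := h.dur_sum
  rw [Fintype.sum_sum_type] at hsum
  have e : M.Ts - ∑ i, dur (Sum.inl i) = ∑ j, dur (Sum.inr j) := by linarith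
  rw [e, Finset.mul_sum]
  refine add_le_add (le_of_eq ?_) (Finset.sum_le_sum fun j _ => ?_)
  · rw [← Finset.sum_subset (Finset.subset_univ S)]
    · refine Finset.sum_congr rfl fun i hi => ?_
      have hi' := (hS i).1 hi
      have hd := ((h.rt_packet i).resolve_left hi').2
      rw [if_neg hi', hd, mul_comm M.Ts, ← div_div]
      ring
    · intro i _ hi
      have : dur (Sum.inl i) = 0 := not_not.1 (mt (hS i).2 hi)
      simp [this]
  · rw [mul_comm ψ]
    exact mul_le_mul_of_nonneg_left
      ((M.le_psiN (hQ j) hX (hg _) (h.pow_mem _).1 (h.pow_mem _).2).trans (hψ j)) (h.dur_nonneg _)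

lemma LambertStrictStep.admissible {B : ℝ} {Y : Fin nR → ℝ} {Q : Fin nN → ℝ} {X : ℝ}
    {g : User nR nN → ℝ} {a : Fin nN → ℝ} {dur pow : User nR nN → ℝ} {adm : Fin nN → ℝ}
    (hQ : ∀ j, 0 ≤ Q j) (hX : 0 ≤ X) (hg : ∀ u, 0 ≤ g u)
    (h : M.LambertStrictStep B Y Q X g a dur pow adm) : M.Admissible g dur pow := by
  obtain ⟨-, s, S, p, ψ, hψ, hψmax, -, hres, -, hpR, hdR, hpN, hdN⟩ := h
  have hψ0 : 0 ≤ ψ := hψ ▸ M.psiN_nonneg (hQ s) hX (hg _)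
  have hf := hres.feasible hX hψ0 fun i => hg (Sum.inl i)
  have hL := M.L_pos
  refine ⟨?_, ?_, ?_, ?_⟩
  · rintro (i | j)
    · rw [hpR]
      split_ifs with hi
      · exact ⟨(hf.1 i hi).1, (hf.1 i hi).2.1⟩
      · exact ⟨le_rfl, M.Pmax_pos.le⟩
    · rw [hpN]
      split_ifs
      · exact M.waterPower_mem _ _ _
      · exact ⟨le_rfl, M.Pmax_pos.le⟩
  · rintro (i | j)
    · rw [hdR]
      split_ifs with hi
      · exact div_nonneg hL.le (hf.1 i hi).2.2.le
      · exact le_rfl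
    · rw [hdN]
      split_ifs
      · linarith [hf.2]
      · exact le_rfl
  · simp [Fintype.sum_sum_type, hdR, hdN, rtTime]
  · intro i
    rw [hdR, hpR]
    split_ifs with hi
    · exact Or.inr ⟨(hf.1 i hi).2.2, rfl⟩
    · exact Or.inl rfl

/-- The algorithm solves the per-slot problem. -/
lemma LambertStrictStep.slotObj_le {B : ℝ} {Y : Fin nR → ℝ} {Q : Fin nN → ℝ} {X : ℝ}
    {g : User nR nN → ℝ} {a : Fin nN → ℝ} {dur pow : User nR nN → ℝ} {adm : Fin nN → ℝ}
    (hQ : ∀ j, 0 ≤ Q j) (hX : 0 ≤ X) (hg : ∀ u, 0 ≤ g u)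
    (h : M.LambertStrictStep B Y Q X g a dur pow adm) {dur' pow' : User nR nN → ℝ}
    (h' : M.Admissible g dur' pow') :
    M.slotObj Y Q X g dur' pow' ≤ M.slotObj Y Q X g dur pow := by
  obtain ⟨-, s, S, p, ψ, hψ, hψmax, -, hres, hbest, hpR, hdR, hpN, hdN⟩ := h
  have hψ0 : 0 ≤ ψ := hψ ▸ M.psiN_nonneg (hQ s) hX (hg _)
  have hf := hres.feasible hX hψ0 fun i => hg (Sum.inl i)
  have hL := M.L_pos
  have hval : M.slotObj Y Q X g dur pow =
      M.setValue X ψ Y (fun i => g (Sum.inl i)) S p := by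
    rw [slotObj_eq, setValue]
    congr 1
    · rw [← Finset.sum_subset (Finset.subset_univ S)]
      · refine Finset.sum_congr rfl fun i hi => ?_
        have hd : dur (Sum.inl i) ≠ 0 := by
          rw [hdR, if_pos hi]
          exact (div_pos hL (hf.1 i hi).2.2).ne'
        rw [if_neg hd, hdR, hpR, if_pos hi, if_pos hi, mul_comm M.Ts, ← div_div]
        ring
      · intro i _ hi
        have : dur (Sum.inl i) = 0 := by rw [hdR, if_neg hi]
        simp [this]
    · simp only [hdN, ite_mul, zero_mul, Finset.sum_ite_eq', Finset.mem_univ, if_true, hpN]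
      rw [hψ, psiN, mul_comm]
  classical
  rw [hval]
  refine (h'.slotObj_le hQ hX hg hψmax (Finset.univ.filter fun i => dur' (Sum.inl i) ≠ 0)
    (by simp)).trans ?_
  exact M.setValue_le_of_best hX hψ0 (fun i => hg _) hbest (h'.feasiblePowers _ (by simp)).1

end Model

/-! ### Measurable selection of the decisions -/

/-- The index that comes first in an enumeration among those satisfying `p` depends measurably on
the point. -/
lemma exists_measurable_selection {α ι : Type*} [MeasurableSpace α] [Countable ι]
    [MeasurableSpace ι] {p : ι → α → Prop} (hp : ∀ i, MeasurableSet {a | p i a})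
    (hex : ∀ a, ∃ i, p i a) : ∃ s : α → ι, Measurable s ∧ ∀ a, p (s a) a := by
  classical
  rcases isEmpty_or_nonempty α with h | h
  · exact ⟨fun a => (h.false a).elim, measurable_of_empty _, fun a => (h.false a).elim⟩
  have : Nonempty ι := ⟨(hex h.some).choose⟩
  obtain ⟨e, he⟩ := exists_surjective_nat ι
  have hex' : ∀ a, ∃ n, p (e n) a := fun a => by
    obtain ⟨i, hi⟩ := hex a
    obtain ⟨n, rfl⟩ := he i
    exact ⟨n, hi⟩
  exact ⟨fun a => e (Nat.find (hex' a)),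
    (measurable_from_nat (f := e)).comp (measurable_find hex' fun n => hp (e n)),
    fun a => Nat.find_spec (hex' a)⟩

lemma measurable_capacity : Measurable fun z : ℝ × ℝ => capacity z.1 z.2 :=
  Real.measurable_log.comp (by fun_prop)

@[fun_prop]
lemma Measurable.capacity {α : Type*} [MeasurableSpace α] {p g : α → ℝ} (hp : Measurable p)
    (hg : Measurable g) : Measurable fun a => Downlink.capacity (p a) (g a) :=
  measurable_capacity.comp (hp.prodMk hg)

/-- The queue lengths `Y, Q, X` and the gains of a slot. -/
abbrev SlotState (nR nN : ℕ) : Type := ((Fin nR → ℝ) × (Fin nN → ℝ) × ℝ) × (User nR nN → ℝ)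

namespace Model

variable {nR nN : ℕ} (M : Model nR nN)

@[fun_prop]
lemma measurable_waterPower {α : Type*} [MeasurableSpace α] {Q X g : α → ℝ} (hQ : Measurable Q)
    (hX : Measurable X) (hg : Measurable g) :
    Measurable fun a => M.waterPower (Q a) (X a) (g a) := by
  have h1 : MeasurableSet {a | g a = 0 ∨ Q a = 0} :=
    (hg (measurableSet_singleton 0)).union (hQ (measurableSet_singleton 0))
  have h2 : MeasurableSet {a | X a = 0} := hX (measurableSet_singleton 0)
  simp only [waterPower]
  exact Measurable.ite h1 measurable_const (Measurable.ite h2 measurable_const (by fun_prop))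

@[fun_prop]
lemma measurable_psiN {α : Type*} [MeasurableSpace α] {Q X g : α → ℝ} (hQ : Measurable Q)
    (hX : Measurable X) (hg : Measurable g) :
    Measurable fun a => M.psiN (Q a) (X a) (g a) := by
  simp only [psiN]
  fun_prop

@[fun_prop]
lemma measurable_rtPower {α : Type*} [MeasurableSpace α] {X ψ φ g : α → ℝ} (hX : Measurable X)
    (hψ : Measurable ψ) (hφ : Measurable φ) (hg : Measurable g) :
    Measurable fun a => M.rtPower (X a) (ψ a) (φ a) (g a) := by
  have h2 : MeasurableSet {a | X a = 0} := hX (measurableSet_singleton 0)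
  have := continuous_lamRatio.measurable
  simp only [rtPower]
  exact Measurable.ite h2 measurable_const (by fun_prop)

@[fun_prop]
lemma measurable_rtTime {α : Type*} [MeasurableSpace α] {g p : α → Fin nR → ℝ}
    (hg : Measurable g) (hp : Measurable p) (S : Finset (Fin nR)) :
    Measurable fun a => M.rtTime (g a) (p a) S := by
  simp only [rtTime]
  fun_prop

@[fun_prop]
lemma measurable_setValue {α : Type*} [MeasurableSpace α] {X ψ : α → ℝ}
    {Y g p : α → Fin nR → ℝ} (hX : Measurable X) (hψ : Measurable ψ) (hY : Measurable Y)
    (hg : Measurable g) (hp : Measurable p) (S : Finset (Fin nR)) :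
    Measurable fun a => M.setValue (X a) (ψ a) (Y a) (g a) S (p a) := by
  simp only [setValue]
  fun_prop

lemma measurableSet_multiplierOK {α : Type*} [MeasurableSpace α] {X ψ : α → ℝ}
    {g : α → Fin nR → ℝ} (hX : Measurable X) (hψ : Measurable ψ) (hg : Measurable g)
    (S : Finset (Fin nR)) (φ : ℝ) :
    MeasurableSet {a | M.MultiplierOK (X a) (ψ a) (g a) S φ} := by
  have ht : Measurable fun a =>
      M.rtTime (g a) (fun i => M.rtPower (X a) (ψ a) φ (g a i)) S := by fun_prop
  refine MeasurableSet.inter ?_ (measurableSet_le ht measurable_const)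
  have : {a | ∀ i ∈ S, 0 < capacity (M.rtPower (X a) (ψ a) φ (g a i)) (g a i)} =
      ⋂ i ∈ S, {a | 0 < capacity (M.rtPower (X a) (ψ a) φ (g a i)) (g a i)} := by
    ext a; simp
  have h := Finset.measurableSet_biInter S (f := fun i =>
    {a | 0 < capacity (M.rtPower (X a) (ψ a) φ (g a i)) (g a i)})
    fun i _ => measurableSet_lt measurable_const (by fun_prop)
  rw [← this] at h
  exact h

lemma measurableSet_discarded {α : Type*} [MeasurableSpace α] {Y g : α → Fin nR → ℝ}
    (hY : Measurable Y) (hg : Measurable g) (S : Finset (Fin nR)) :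
    MeasurableSet {a | Discarded (Y a) (g a) S} := by
  have : {a | Discarded (Y a) (g a) S} =
      ⋃ i, ⋃ (_ : i ∉ S), ⋃ j, ⋃ (_ : j ∈ S), {a | Y a j < Y a i} ∩ {a | g a j < g a i} := by
    ext a
    simp only [Set.mem_iUnion, Set.mem_inter_iff, Set.mem_ofPred_eq, Discarded, exists_prop]
  rw [this]
  exact MeasurableSet.iUnion fun i => MeasurableSet.iUnion fun _ => MeasurableSet.iUnion fun j =>
    MeasurableSet.iUnion fun _ => (measurableSet_lt (by fun_prop) (by fun_prop)).inter
      (measurableSet_lt (by fun_prop) (by fun_prop))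

open Classical in
/-- The least multiplier at which `S` can be served within one slot, as an infimum over
rationals. -/
def leastMultiplier (X ψ : ℝ) (g : Fin nR → ℝ) (S : Finset (Fin nR)) : ℝ :=
  (⨅ r : ℚ, if 0 ≤ r ∧ M.MultiplierOK X ψ g S r then ENNReal.ofReal r else ⊤).toReal

@[fun_prop]
lemma measurable_leastMultiplier {α : Type*} [MeasurableSpace α] {X ψ : α → ℝ}
    {g : α → Fin nR → ℝ} (hX : Measurable X) (hψ : Measurable ψ) (hg : Measurable g)
    (S : Finset (Fin nR)) :
    Measurable fun a => M.leastMultiplier (X a) (ψ a) (g a) S := by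
  classical
  refine ENNReal.measurable_toReal.comp (Measurable.iInf fun r => ?_)
  refine Measurable.ite ?_ measurable_const measurable_const
  exact (MeasurableSet.const _).inter (M.measurableSet_multiplierOK hX hψ hg S r)

/-- Some rational multiplier allows to serve `S` within one slot. -/
def Servable (X ψ : ℝ) (g : Fin nR → ℝ) (S : Finset (Fin nR)) : Prop :=
  ∃ r : ℚ, 0 ≤ r ∧ M.MultiplierOK X ψ g S r

lemma measurableSet_servable {α : Type*} [MeasurableSpace α] {X ψ : α → ℝ}
    {g : α → Fin nR → ℝ} (hX : Measurable X) (hψ : Measurable ψ) (hg : Measurable g)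
    (S : Finset (Fin nR)) : MeasurableSet {a | M.Servable (X a) (ψ a) (g a) S} := by
  have : {a | M.Servable (X a) (ψ a) (g a) S} =
      ⋃ r : ℚ, {_a | 0 ≤ r} ∩ {a | M.MultiplierOK (X a) (ψ a) (g a) S r} := by
    ext a; simp [Servable]
  rw [this]
  exact MeasurableSet.iUnion fun r =>
    (MeasurableSet.const _).inter (M.measurableSet_multiplierOK hX hψ hg S r)

variable {M}

lemma FeasiblePowers.servable {X ψ : ℝ} {g : Fin nR → ℝ} {S : Finset (Fin nR)} {p : Fin nR → ℝ}
    (hX : 0 ≤ X) (hg : ∀ i, 0 ≤ g i) (h : M.FeasiblePowers g S p) : M.Servable X ψ g S := by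
  obtain ⟨φ, h0, hφ⟩ := h.exists_multiplierOK ψ hX hg
  obtain ⟨r, hr⟩ := exists_rat_gt φ
  exact ⟨r, by exact_mod_cast h0.trans hr.le, hφ.mono hX hg hr.le⟩

/-- Multipliers that work form an up-set, so every rational above the least real one works and the
infimum over rationals equals it. Servability excludes the empty infimum, for which `⊤.toReal` would
be `0`. -/
lemma Servable.isSearchResult {X ψ : ℝ} {g : Fin nR → ℝ} {S : Finset (Fin nR)}
    (hX : 0 ≤ X) (hψ : 0 ≤ ψ) (hg : ∀ i, 0 ≤ g i) (h : M.Servable X ψ g S) :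
    M.IsSearchResult X ψ g S
      fun i => M.rtPower X ψ (M.leastMultiplier X ψ g S) (g i) := by
  classical
  obtain ⟨r, hr0, hr⟩ := h
  obtain ⟨φ, hφ⟩ := M.exists_isLeast_multiplier (X := X) (ψ := ψ) hg
    ⟨r, by exact_mod_cast hr0, hr⟩
  have hφ0 : 0 ≤ φ := hφ.1.1
  have : M.leastMultiplier X ψ g S = φ := by
    rw [leastMultiplier, ← ENNReal.toReal_ofReal hφ0]
    congr 1
    apply le_antisymm
    · by_contra hlt
      obtain ⟨q, hq0, h1, h2⟩ := ENNReal.lt_iff_exists_rat_btwn.1 (not_le.1 hlt)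
      have h1' : φ < q := by
        have := ENNReal.lt_ofReal_iff_toReal_lt (a := ENNReal.ofReal φ) (by simp) |>.1 h1
        rwa [ENNReal.toReal_ofReal hφ0] at this
      refine (iInf_le_of_le q ?_).not_gt h2
      rw [if_pos ⟨hq0, hφ.1.2.mono hX hg h1'.le⟩]
      exact le_rfl
    · refine le_iInf fun q => ?_
      split_ifs with hq
      · exact ENNReal.ofReal_le_ofReal (hφ.2 ⟨by exact_mod_cast hq.1, hq.2⟩)
      · exact le_top
  rw [this]
  exact M.isSearchResult_of_isLeast hX hψ hg hφ

variable (M)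

/-- The decisions of the algorithm can be taken in a measurable way. -/
theorem exists_measurable_step (hN : 0 < nN) :
    ∃ dur pow : SlotState nR nN → User nR nN → ℝ,
      Measurable dur ∧ Measurable pow ∧
      ∀ z, (∀ j, 0 ≤ z.1.2.1 j) → 0 ≤ z.1.2.2 → (∀ u, 0 ≤ z.2 u) → ∀ (B : ℝ) (a : Fin nN → ℝ),
        M.LambertStrictStep B z.1.1 z.1.2.1 z.1.2.2 z.2 a (dur z) (pow z)
          (fun j => if z.1.2.1 j < B then a j else 0) := by
  classical
  let Y : SlotState nR nN → Fin nR → ℝ := fun z => z.1.1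
  let Q : SlotState nR nN → Fin nN → ℝ := fun z => z.1.2.1
  let X : SlotState nR nN → ℝ := fun z => z.1.2.2
  let gR : SlotState nR nN → Fin nR → ℝ := fun z i => z.2 (Sum.inl i)
  let gN : SlotState nR nN → Fin nN → ℝ := fun z j => z.2 (Sum.inr j)
  have hY : Measurable Y := by fun_prop
  have hQ : Measurable Q := by fun_prop
  have hX : Measurable X := by fun_prop
  have hgR : Measurable gR := by fun_prop
  have hgN : Measurable gN := by fun_prop
  let Ψ : Fin nN → SlotState nR nN → ℝ := fun j z => M.psiN (Q z j) (X z) (gN z j)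
  have hΨ : ∀ j, Measurable (Ψ j) := fun j => by fun_prop
  let p : Fin nN → Finset (Fin nR) → SlotState nR nN → Fin nR → ℝ := fun s S z i =>
    M.rtPower (X z) (Ψ s z) (M.leastMultiplier (X z) (Ψ s z) (gR z) S) (gR z i)
  have hp : ∀ s S, Measurable (p s S) := fun s S => by
    have := hΨ s
    fun_prop
  let V : Fin nN → Finset (Fin nR) → SlotState nR nN → ℝ := fun s S z =>
    M.setValue (X z) (Ψ s z) (Y z) (gR z) S (p s S z)
  have hV : ∀ s S, Measurable (V s S) := fun s S => by
    have := hΨ s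
    have := hp s S
    fun_prop
  let ok : Fin nN → Finset (Fin nR) → SlotState nR nN → Prop := fun s S z =>
    ¬ Discarded (Y z) (gR z) S ∧ M.Servable (X z) (Ψ s z) (gR z) S
  have hok : ∀ s S, MeasurableSet {z | ok s S z} := fun s S =>
    (measurableSet_discarded hY hgR S).compl.inter
      (M.measurableSet_servable hX (hΨ s) hgR S)
  let _ : MeasurableSpace (Fin nN × Finset (Fin nR)) := ⊤
  obtain ⟨σ, hσ, hσ'⟩ := exists_measurable_selection
    (p := fun (ι : Fin nN × Finset (Fin nR)) (z : SlotState nR nN) => (∀ j, Ψ j z ≤ Ψ ι.1 z) ∧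
      ok ι.1 ι.2 z ∧ ∀ S', ok ι.1 S' z → V ι.1 S' z ≤ V ι.1 ι.2 z)
    (fun ι => by
      have h1 : MeasurableSet {z | ∀ j, Ψ j z ≤ Ψ ι.1 z} := by
        rw [Set.ofPred_forall]
        exact MeasurableSet.iInter fun j => measurableSet_le (hΨ j) (hΨ _)
      have h2 : MeasurableSet {z | ∀ S', ok ι.1 S' z → V ι.1 S' z ≤ V ι.1 ι.2 z} := by
        rw [Set.ofPred_forall]
        exact MeasurableSet.iInter fun S' => (hok _ S').imp (measurableSet_le (hV _ _) (hV _ _))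
      exact h1.inter ((hok _ _).inter h2))
    (fun z => by
      have : Nonempty (Fin nN) := ⟨⟨0, hN⟩⟩
      obtain ⟨s, hs⟩ := Finite.exists_max fun j => Ψ j z
      -- The empty set is always a candidate: it is not discarded and the multiplier `0` serves it.
      obtain ⟨S, hS, hmax⟩ := Finset.exists_max_image
        (Finset.univ.filter fun S => ok s S z) (fun S => V s S z)
        ⟨∅, by
          rw [Finset.mem_filter]
          refine ⟨Finset.mem_univ _, by simp [Discarded], 0, le_rfl, by simp, ?_⟩
          simp [rtTime, M.Ts_pos.le]⟩
      refine ⟨(s, S), hs, by simpa using hS, fun S' hS' => hmax S' (by simpa using hS')⟩)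
  let pow : Fin nN × Finset (Fin nR) → SlotState nR nN → User nR nN → ℝ := fun ι z => Sum.elim
    (fun i => if i ∈ ι.2 then p ι.1 ι.2 z i else 0)
    (fun j => if j = ι.1 then M.waterPower (Q z ι.1) (X z) (gN z ι.1) else 0)
  let dur : Fin nN × Finset (Fin nR) → SlotState nR nN → User nR nN → ℝ := fun ι z => Sum.elim
    (fun i => if i ∈ ι.2 then M.L / capacity (p ι.1 ι.2 z i) (gR z i) else 0)
    (fun j => if j = ι.1 then M.Ts - M.rtTime (gR z) (p ι.1 ι.2 z) ι.2 else 0)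
  have hpow : ∀ ι, Measurable (pow ι) := fun ι => by
    refine measurable_pi_lambda _ ?_
    rintro (i | j) <;> simp only [pow, Sum.elim_inl, Sum.elim_inr]
    · have := hp ι.1 ι.2
      split_ifs <;> fun_prop
    · split_ifs <;> fun_prop
  have hdur : ∀ ι, Measurable (dur ι) := fun ι => by
    refine measurable_pi_lambda _ ?_
    have := hp ι.1 ι.2
    rintro (i | j) <;> simp only [dur, Sum.elim_inl, Sum.elim_inr]
    · split_ifs <;> fun_prop
    · split_ifs <;> fun_prop
  refine ⟨fun z => dur (σ z) z, fun z => pow (σ z) z,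
    (measurable_from_prod_countable_right (f := fun q => dur q.1 q.2) hdur).comp (hσ.prodMk measurable_id),
    (measurable_from_prod_countable_right (f := fun q => pow q.1 q.2) hpow).comp (hσ.prodMk measurable_id), ?_⟩
  intro z hQ0 hX0 hg0 B a
  obtain ⟨h1, ⟨h2, h3⟩, h4⟩ := hσ' z
  have hψ0 : 0 ≤ Ψ (σ z).1 z := M.psiN_nonneg (hQ0 _) hX0 (hg0 _)
  refine ⟨fun j => rfl, (σ z).1, (σ z).2, p (σ z).1 (σ z).2 z, Ψ (σ z).1 z, rfl, h1, h2,
    h3.isSearchResult hX0 hψ0 fun i => hg0 _, fun S' p' hd hres => ?_, fun i => rfl, fun i => rfl,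
    fun j => rfl, fun j => rfl⟩
  -- A competing search result for `S'` may use a different multiplier. It is dominated by the
  -- powers of the least multiplier for the same `S'`, and these by the selected set.
  have hf := hres.feasible hX0 hψ0 fun i => hg0 _
  have hsv : M.Servable (X z) (Ψ (σ z).1 z) (gR z) S' := hf.servable hX0 fun i => hg0 _
  exact ((hsv.isSearchResult hX0 hψ0 fun i => hg0 _).setValue_le hX0 hψ0 (fun i => hg0 _) hf).trans
    (h4 S' ⟨hd, hsv⟩)

end Model

variable {nR nN : ℕ}

/-! ### The per-slot optimum -/

namespace Model

variable (M : Model nR nN)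

/-- The optimal value of the per-slot problem is a measurable function of the state. -/
theorem exists_measurable_optimum (hN : 0 < nN) : ∃ G : SlotState nR nN → ℝ, Measurable G ∧
    ∀ z, (∀ j, 0 ≤ z.1.2.1 j) → 0 ≤ z.1.2.2 → (∀ u, 0 ≤ z.2 u) →
      IsGreatest {v | ∃ dur pow, M.Admissible z.2 dur pow ∧
        M.slotObj z.1.1 z.1.2.1 z.1.2.2 z.2 dur pow = v} (G z) := by
  obtain ⟨dur, pow, hdur, hpow, h⟩ := M.exists_measurable_step hN
  refine ⟨fun z => M.slotObj z.1.1 z.1.2.1 z.1.2.2 z.2 (dur z) (pow z), ?_, ?_⟩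
  · have : ∀ i, Measurable fun z => if dur z (Sum.inl i) = 0 then (0 : ℝ) else 1 := fun i =>
      Measurable.ite (by
        have : Measurable fun z => dur z (Sum.inl i) := by fun_prop
        exact this (measurableSet_singleton 0)) measurable_const measurable_const
    simp only [slotObj]
    fun_prop
  · intro z hQ hX hg
    -- Threshold and arrivals influence only the admissions, which do not occur in `slotObj`; both
    -- are set to zero.
    have hstep := h z hQ hX hg 0 0
    refine ⟨⟨_, _, hstep.admissible hQ hX hg, rfl⟩, ?_⟩
    rintro v ⟨dur', pow', h', rfl⟩
    exact hstep.slotObj_le hQ hX hg h'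

variable {M}

lemma Admissible.dur_le {g dur pow : User nR nN → ℝ} (h : M.Admissible g dur pow)
    (u : User nR nN) : dur u ≤ M.Ts := by
  rw [← h.dur_sum]
  exact Finset.single_le_sum (fun v _ => h.dur_nonneg v) (Finset.mem_univ u)

lemma Admissible.slotPower_mem {g dur pow : User nR nN → ℝ} (h : M.Admissible g dur pow) :
    0 ≤ (∑ u, pow u * dur u) / M.Ts ∧ (∑ u, pow u * dur u) / M.Ts ≤ M.Pmax := by
  have hT := M.Ts_pos
  constructor
  · exact div_nonneg
      (Finset.sum_nonneg fun u _ => mul_nonneg (h.pow_mem u).1 (h.dur_nonneg u)) hT.le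
  · rw [div_le_iff₀ hT]
    calc ∑ u, pow u * dur u ≤ ∑ u, M.Pmax * dur u := Finset.sum_le_sum fun u _ =>
          mul_le_mul_of_nonneg_right (h.pow_mem u).2 (h.dur_nonneg u)
      _ = M.Pmax * M.Ts := by rw [← Finset.mul_sum, h.dur_sum]

lemma Admissible.bits_mem {g dur pow : User nR nN → ℝ} (h : M.Admissible g dur pow)
    {u : User nR nN} (hg : 0 ≤ g u ∧ g u ≤ M.gmax) :
    0 ≤ dur u * capacity (pow u) (g u) ∧ dur u * capacity (pow u) (g u) ≤ M.Ts * M.Rmax := by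
  have hc := capacity_nonneg (h.pow_mem u).1 hg.1
  exact ⟨mul_nonneg (h.dur_nonneg u) hc, mul_le_mul (h.dur_le u)
    (capacity_mono (h.pow_mem u).1 hg.1 (h.pow_mem u).2 hg.2) hc M.Ts_pos.le⟩

lemma Admissible.rt_bits {g dur pow : User nR nN → ℝ} (h : M.Admissible g dur pow) (i : Fin nR) :
    dur (Sum.inl i) * capacity (pow (Sum.inl i)) (g (Sum.inl i)) / M.L =
      if dur (Sum.inl i) = 0 then 0 else 1 := by
  split_ifs with h0
  · rw [h0, zero_mul, zero_div]
  · obtain ⟨h1, h2⟩ := (h.rt_packet i).resolve_left h0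
    rw [h2, div_mul_cancel₀ _ h1.ne', div_self M.L_pos.ne']

lemma Admissible.abs_slotObj_le {g dur pow : User nR nN → ℝ} (h : M.Admissible g dur pow)
    (hg : ∀ u, 0 ≤ g u ∧ g u ≤ M.gmax) {Y : Fin nR → ℝ} {Q : Fin nN → ℝ} {X : ℝ}
    (hY : ∀ i, 0 ≤ Y i) (hQ : ∀ j, 0 ≤ Q j) (hX : 0 ≤ X) :
    |M.slotObj Y Q X g dur pow| ≤ ∑ i, Y i + ∑ j, Q j * (M.Ts * M.Rmax) + X * M.Pmax := by
  have h1 : 0 ≤ ∑ i, Y i * (if dur (Sum.inl i) = 0 then 0 else 1) ∧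
      ∑ i, Y i * (if dur (Sum.inl i) = 0 then 0 else 1) ≤ ∑ i, Y i := by
    constructor
    · exact Finset.sum_nonneg fun i _ => mul_nonneg (hY i) (by split_ifs <;> norm_num)
    · refine Finset.sum_le_sum fun i _ => ?_
      have := hY i
      split_ifs <;> simp [this]
  have h2 : 0 ≤ ∑ j, Q j * (dur (Sum.inr j) * capacity (pow (Sum.inr j)) (g (Sum.inr j))) ∧
      ∑ j, Q j * (dur (Sum.inr j) * capacity (pow (Sum.inr j)) (g (Sum.inr j))) ≤
        ∑ j, Q j * (M.Ts * M.Rmax) :=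
    ⟨Finset.sum_nonneg fun j _ => mul_nonneg (hQ j) (h.bits_mem (hg _)).1,
      Finset.sum_le_sum fun j _ => mul_le_mul_of_nonneg_left (h.bits_mem (hg _)).2 (hQ j)⟩
  have h3 := mul_nonneg hX h.slotPower_mem.1
  have h4 := mul_le_mul_of_nonneg_left h.slotPower_mem.2 hX
  rw [slotObj, abs_le]
  constructor <;> linarith

end Model

/-! ### The random environment -/

namespace Realization

variable {M : Model nR nN} (E : Realization M)

lemma measurable_gain (k : ℕ) (u : User nR nN) : Measurable (E.gain k u) :=
  (E.gain_meas k u).mono (E.ℱ.le k) le_rfl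

lemma measurable_arr (k : ℕ) (u : User nR nN) : Measurable (E.arr k u) :=
  (E.arr_meas k u).mono (E.ℱ.le k) le_rfl

lemma arr_bounds (k : ℕ) (u : User nR nN) (ω : E.Ω) : 0 ≤ E.arr k u ω ∧ E.arr k u ω ≤ 1 := by
  rcases E.arr_mem k u ω with h | h <;> rw [h] <;> norm_num

lemma gain_bounds (k : ℕ) : ∀ᵐ ω ∂E.P, ∀ u, 0 ≤ E.gain k u ω ∧ E.gain k u ω ≤ M.gmax := by
  refine ae_all_iff.2 fun u => ?_
  have h : ∀ᵐ x ∂(E.P.map (E.gain k u)), x ∈ Set.Icc 0 M.gmax := by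
    rw [E.gain_law k u]
    exact M.chan_supp u
  exact ae_of_ae_map (E.measurable_gain k u).aemeasurable h

/-- The joint law of the gains in a slot depends on the model alone. This allows policies on
different probability spaces to be compared through one integral over `Measure.pi M.chan`. -/
lemma map_gain (k : ℕ) : E.P.map (fun ω u => E.gain k u ω) = Measure.pi M.chan := by
  have h := (E.indep_users k).precomp (g := (Sum.inl : User nR nN → User nR nN ⊕ User nR nN))
    Sum.inl_injective
  have h' : iIndepFun (fun u : User nR nN => E.gain k u) E.P := h
  rw [(iIndepFun_iff_map_fun_eq_pi_map fun u => (E.measurable_gain k u).aemeasurable).1 h']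
  simp_rw [E.gain_law k]

lemma integral_arr (k : ℕ) (u : User nR nN) : ∫ ω, E.arr k u ω ∂E.P = M.lam u := by
  have hs : MeasurableSet {ω | E.arr k u ω = 1} := E.measurable_arr k u (measurableSet_singleton 1)
  rw [← E.arr_law k u, ← integral_indicator_one hs]
  refine integral_congr_ae (Eventually.of_forall fun ω => ?_)
  rcases E.arr_mem k u ω with h | h <;> simp [h]

lemma integrable_arr (k : ℕ) (u : User nR nN) : Integrable (E.arr k u) E.P :=
  Integrable.of_mem_Icc 0 1 (E.measurable_arr k u).aemeasurable
    (Eventually.of_forall fun ω => E.arr_bounds k u ω)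

end Realization

/-! ### Queues -/

namespace Policy

variable {M : Model nR nN} {E : Realization M} (π : Policy E)

lemma Q_nonneg (k : ℕ) (j : Fin nN) (ω : E.Ω) : 0 ≤ π.Q k j ω := by
  cases k
  · exact le_rfl
  · exact le_max_right _ _

lemma Y_nonneg (k : ℕ) (i : Fin nR) (ω : E.Ω) : 0 ≤ π.Y k i ω := by
  cases k
  · exact le_rfl
  · exact le_max_right _ _

lemma X_nonneg (k : ℕ) (ω : E.Ω) : 0 ≤ π.X k ω := by
  cases k
  · exact le_rfl
  · exact le_max_right _ _

/-- The queue lengths `Y, Q, X` at the beginning of slot `k`. -/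
def queues (k : ℕ) (ω : E.Ω) : (Fin nR → ℝ) × (Fin nN → ℝ) × ℝ :=
  (fun i => π.Y k i ω, fun j => π.Q k j ω, π.X k ω)

lemma measurable_rate (k : ℕ) (u : User nR nN) : Measurable[E.ℱ k] (π.rate k u) :=
  measurable_capacity.comp ((π.pow_meas k u).prodMk (E.gain_meas k u))

lemma measurable_slotPower (k : ℕ) : Measurable[E.ℱ k] (π.slotPower k) :=
  (Finset.measurable_fun_sum _ fun u _ => (π.pow_meas k u).mul (π.dur_meas k u)).div_const _

lemma measurable_prod_pi {α : Type*} {m : MeasurableSpace α} {a : α → Fin nR → ℝ}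
    {b : α → Fin nN → ℝ} {c : α → ℝ} (ha : ∀ i, Measurable fun x => a x i)
    (hb : ∀ j, Measurable fun x => b x j) (hc : Measurable c) :
    Measurable fun x => (a x, b x, c x) := by
  fun_prop

lemma queues_zero : π.queues 0 = fun _ => (fun _ => 0, fun _ => 0, 0) := rfl

/-- The queues at the start of slot `k + 1` are determined by the information of slot `k`. This
shift by one slot is what makes them independent of the gains and arrivals of slot `k + 1`. -/
lemma measurable_queues_succ (k : ℕ) : Measurable[E.ℱ k] (π.queues (k + 1)) := by
  have h : ∀ k, Measurable[E.ℱ k] (π.queues k) → Measurable[E.ℱ k] (π.queues (k + 1)) :=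
    fun k hk => by
      have hY : ∀ i, Measurable[E.ℱ k] (π.Y k i) := fun i =>
        (measurable_pi_apply i).comp (measurable_fst.comp hk)
      have hQ : ∀ j, Measurable[E.ℱ k] (π.Q k j) := fun j =>
        (measurable_pi_apply j).comp (measurable_fst.comp (measurable_snd.comp hk))
      have hX : Measurable[E.ℱ k] (π.X k) := measurable_snd.comp (measurable_snd.comp hk)
      refine measurable_prod_pi (m := E.ℱ k) (fun i => ?_) (fun j => ?_) ?_
      · exact Measurable.max (Measurable.sub
          (Measurable.add (hY i) (Measurable.mul_const (E.arr_meas k _) _))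
          (Measurable.ite (π.dur_meas k _ (measurableSet_singleton 0)) measurable_const
            measurable_const)) measurable_const
      · exact Measurable.max (Measurable.sub
          (Measurable.add (hQ j) (Measurable.const_mul (π.adm_meas k j) _))
          (Measurable.mul (π.dur_meas k _) (π.measurable_rate k _))) measurable_const
      · exact Measurable.max (Measurable.sub (Measurable.add hX (π.measurable_slotPower k))
          measurable_const) measurable_const
  induction k with
  | zero => exact h 0 (by rw [queues_zero]; exact measurable_const)
  | succ k ih => exact h (k + 1) (ih.mono (E.ℱ.mono k.le_succ) le_rfl)

lemma measurable_queues (k : ℕ) : Measurable (π.queues k) := by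
  cases k with
  | zero => rw [queues_zero]; exact measurable_const
  | succ k => exact (π.measurable_queues_succ k).mono (E.ℱ.le k) le_rfl

lemma measurable_Y (k : ℕ) (i : Fin nR) : Measurable (π.Y k i) :=
  (measurable_pi_apply i).comp (measurable_fst.comp (π.measurable_queues k))

lemma measurable_Q (k : ℕ) (j : Fin nN) : Measurable (π.Q k j) :=
  (measurable_pi_apply j).comp (measurable_fst.comp (measurable_snd.comp (π.measurable_queues k)))

lemma measurable_X (k : ℕ) : Measurable (π.X k) :=
  measurable_snd.comp (measurable_snd.comp (π.measurable_queues k))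

lemma measurable_dur (k : ℕ) (u : User nR nN) : Measurable (π.dur k u) :=
  (π.dur_meas k u).mono (E.ℱ.le k) le_rfl

lemma measurable_adm (k : ℕ) (j : Fin nN) : Measurable (π.adm k j) :=
  (π.adm_meas k j).mono (E.ℱ.le k) le_rfl

lemma measurable_rate' (k : ℕ) (u : User nR nN) : Measurable (π.rate k u) :=
  (π.measurable_rate k u).mono (E.ℱ.le k) le_rfl

lemma measurable_slotPower' (k : ℕ) : Measurable (π.slotPower k) :=
  (π.measurable_slotPower k).mono (E.ℱ.le k) le_rfl

lemma measurable_delivered (k : ℕ) (j : Fin nN) : Measurable (π.delivered k j) :=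
  Measurable.min ((π.measurable_dur k _).mul (π.measurable_rate' k _))
    ((π.measurable_Q k j).add ((π.measurable_adm k j).const_mul _))

/-- The queues at the beginning of a slot are independent of the gains and arrivals in it. -/
lemma indepFun_queues (k : ℕ) :
    IndepFun (π.queues k) (fun ω u => (E.gain k u ω, E.arr k u ω)) E.P := by
  cases k with
  | zero => exact indepFun_const_left (0, 0, 0) _
  | succ k =>
    rw [IndepFun_iff_Indep]
    exact (indep_of_indep_of_le_right (E.indep_past k) (π.measurable_queues_succ k).comap_le).symm

/-- The minimum in `delivered` absorbs the positive part in the queue recursion, so bits are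
conserved exactly and the recursion telescopes. -/
lemma Q_succ (k : ℕ) (j : Fin nN) (ω : E.Ω) :
    π.Q (k + 1) j ω = π.Q k j ω + M.L * π.adm k j ω - π.delivered k j ω := by
  rw [Q, delivered]
  rcases le_total (π.dur k (Sum.inr j) ω * π.rate k (Sum.inr j) ω)
    (π.Q k j ω + M.L * π.adm k j ω) with h | h
  · rw [min_eq_left h, max_eq_left (by linarith)]
  · rw [min_eq_right h, max_eq_right (by linarith), sub_self]

/-- The per-slot constraints. -/
structure IsRegular : Prop where
  admission : ∀ k, ∀ᵐ ω ∂E.P, ∀ j,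
    (π.adm k j ω = 0 ∨ π.adm k j ω = 1) ∧ π.adm k j ω ≤ E.arr k (Sum.inr j) ω
  admissible : ∀ k, ∀ᵐ ω ∂E.P,
    M.Admissible (fun u => E.gain k u ω) (fun u => π.dur k u ω) (fun u => π.pow k u ω)

variable {π}

lemma IsFeasible.isRegular (h : π.IsFeasible) : π.IsRegular := by
  refine ⟨h.admission, fun k => ?_⟩
  filter_upwards [h.peakPower k, h.dur_nonneg k, h.dur_sum k, h.rt_packet k] with ω h1 h2 h3 h4
  exact ⟨h1, h2, h3, h4⟩

lemma IsLambertStrict.isRegular {B : ℝ} (h : π.IsLambertStrict B) : π.IsRegular := by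
  refine ⟨fun k => ?_, fun k => ?_⟩
  · filter_upwards [h k] with ω h1 j
    rw [show π.adm k j ω = _ from h1.1 j]
    have := E.arr_bounds k (Sum.inr j) ω
    split_ifs
    · exact ⟨E.arr_mem _ _ _, le_rfl⟩
    · exact ⟨Or.inl rfl, this.1⟩
  · filter_upwards [h k, E.gain_bounds k] with ω h1 h2
    exact h1.admissible (fun j => π.Q_nonneg k j ω) (π.X_nonneg k ω) fun u => (h2 u).1

namespace IsRegular

lemma adm_mem (h : π.IsRegular) (k : ℕ) : ∀ᵐ ω ∂E.P, ∀ j, 0 ≤ π.adm k j ω ∧ π.adm k j ω ≤ 1 := by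
  filter_upwards [h.admission k] with ω h1 j
  rcases (h1 j).1 with h2 | h2 <;> rw [h2] <;> norm_num

lemma slotPower_mem (h : π.IsRegular) (k : ℕ) :
    ∀ᵐ ω ∂E.P, 0 ≤ π.slotPower k ω ∧ π.slotPower k ω ≤ M.Pmax := by
  filter_upwards [h.admissible k] with ω h1
  exact h1.slotPower_mem

lemma bits_mem (h : π.IsRegular) (k : ℕ) : ∀ᵐ ω ∂E.P, ∀ u,
    0 ≤ π.dur k u ω * π.rate k u ω ∧ π.dur k u ω * π.rate k u ω ≤ M.Ts * M.Rmax := by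
  filter_upwards [h.admissible k, E.gain_bounds k] with ω h1 h2 u
  exact h1.bits_mem (h2 u)

lemma rt_bits (h : π.IsRegular) (k : ℕ) : ∀ᵐ ω ∂E.P, ∀ i,
    π.dur k (Sum.inl i) ω * π.rate k (Sum.inl i) ω / M.L =
      if π.dur k (Sum.inl i) ω = 0 then 0 else 1 := by
  filter_upwards [h.admissible k] with ω h1 i
  exact h1.rt_bits i

/-- These linear bounds on the queues are crude; they provide integrability of the queues and of
their squares. -/
lemma Q_le (h : π.IsRegular) (k : ℕ) : ∀ᵐ ω ∂E.P, ∀ j, π.Q k j ω ≤ k * M.L := by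
  have hL := M.L_pos
  induction k with
  | zero => exact Eventually.of_forall fun ω j => by simp [Q]
  | succ k ih =>
    filter_upwards [ih, h.adm_mem k, h.bits_mem k] with ω h1 h2 h3 j
    rw [Q]
    push_cast
    have h4 := mul_le_mul_of_nonneg_left (h2 j).2 hL.le
    exact max_le (by linarith [h1 j, (h3 (Sum.inr j)).1]) (by positivity)

lemma X_le (h : π.IsRegular) (k : ℕ) : ∀ᵐ ω ∂E.P, π.X k ω ≤ k * M.Pmax := by
  have hP := M.Pmax_pos
  have hP' := M.Pavg_pos
  induction k with
  | zero => exact Eventually.of_forall fun ω => by simp [X]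
  | succ k ih =>
    filter_upwards [ih, h.slotPower_mem k] with ω h1 h2
    rw [X]
    push_cast
    exact max_le (by linarith) (by positivity)

end IsRegular

lemma Y_le (π : Policy E) (k : ℕ) (i : Fin nR) (ω : E.Ω) : π.Y k i ω ≤ k := by
  induction k with
  | zero => simp [Y]
  | succ k ih =>
    rw [Y]
    push_cast
    have h1 := E.arr_bounds k (Sum.inl i) ω
    have h2 := M.q_mem i
    have h3 : E.arr k (Sum.inl i) ω * M.q i ≤ 1 := mul_le_one₀ h1.2 h2.1 h2.2
    refine max_le ?_ (by positivity)
    split_ifs <;> linarith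

lemma integrable_Y (π : Policy E) (k : ℕ) (i : Fin nR) : Integrable (π.Y k i) E.P :=
  Integrable.of_mem_Icc 0 k (π.measurable_Y k i).aemeasurable
    (Eventually.of_forall fun ω => ⟨π.Y_nonneg k i ω, π.Y_le k i ω⟩)

namespace IsRegular

lemma integrable_Q (h : π.IsRegular) (k : ℕ) (j : Fin nN) : Integrable (π.Q k j) E.P :=
  Integrable.of_mem_Icc 0 (k * M.L) (π.measurable_Q k j).aemeasurable
    ((h.Q_le k).mono fun ω h1 => ⟨π.Q_nonneg k j ω, h1 j⟩)

lemma integrable_X (h : π.IsRegular) (k : ℕ) : Integrable (π.X k) E.P :=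
  Integrable.of_mem_Icc 0 (k * M.Pmax) (π.measurable_X k).aemeasurable
    ((h.X_le k).mono fun ω h1 => ⟨π.X_nonneg k ω, h1⟩)

lemma integrable_adm (h : π.IsRegular) (k : ℕ) (j : Fin nN) : Integrable (π.adm k j) E.P :=
  Integrable.of_mem_Icc 0 1 (π.measurable_adm k j).aemeasurable ((h.adm_mem k).mono fun _ h1 => h1 j)

lemma integrable_slotPower (h : π.IsRegular) (k : ℕ) : Integrable (π.slotPower k) E.P :=
  Integrable.of_mem_Icc 0 M.Pmax (π.measurable_slotPower' k).aemeasurable (h.slotPower_mem k)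

lemma integrable_bits (h : π.IsRegular) (k : ℕ) (u : User nR nN) :
    Integrable (fun ω => π.dur k u ω * π.rate k u ω) E.P :=
  Integrable.of_mem_Icc 0 (M.Ts * M.Rmax)
    ((π.measurable_dur k u).mul (π.measurable_rate' k u)).aemeasurable
    ((h.bits_mem k).mono fun _ h1 => h1 u)

lemma delivered_mem (h : π.IsRegular) (k : ℕ) : ∀ᵐ ω ∂E.P, ∀ j,
    0 ≤ π.delivered k j ω ∧ π.delivered k j ω ≤ M.Ts * M.Rmax := by
  filter_upwards [h.bits_mem k, h.adm_mem k] with ω h1 h2 j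
  have := mul_nonneg M.L_pos.le (h2 j).1
  exact ⟨le_min (h1 _).1 (by linarith [π.Q_nonneg k j ω]), (min_le_left _ _).trans (h1 _).2⟩

lemma integrable_delivered (h : π.IsRegular) (k : ℕ) (j : Fin nN) :
    Integrable (π.delivered k j) E.P :=
  Integrable.of_mem_Icc 0 (M.Ts * M.Rmax) (π.measurable_delivered k j).aemeasurable
    ((h.delivered_mem k).mono fun _ h1 => h1 j)

lemma sum_integral_delivered (h : π.IsRegular) (K : ℕ) (j : Fin nN) :
    ∑ k ∈ Finset.range K, ∫ ω, π.delivered k j ω ∂E.P =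
      ∑ k ∈ Finset.range K, M.L * ∫ ω, π.adm k j ω ∂E.P - ∫ ω, π.Q K j ω ∂E.P := by
  induction K with
  | zero => simp [Q]
  | succ K ih =>
    have e : ∫ ω, π.Q (K + 1) j ω ∂E.P =
        ∫ ω, π.Q K j ω ∂E.P + M.L * ∫ ω, π.adm K j ω ∂E.P - ∫ ω, π.delivered K j ω ∂E.P := by
      have hi : Integrable (fun ω => π.Q K j ω + M.L * π.adm K j ω) E.P :=
        (h.integrable_Q K j).add ((h.integrable_adm K j).const_mul _)
      simp_rw [π.Q_succ]
      rw [integral_sub hi (h.integrable_delivered K j), integral_add (h.integrable_Q K j)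
        ((h.integrable_adm K j).const_mul _), integral_const_mul]
    rw [Finset.sum_range_succ, Finset.sum_range_succ, ih, e]
    ring

end IsRegular
end Policy

/-! ### Comparison of arbitrary policies with the per-slot optimum -/

instance (M : Model nR nN) (u : User nR nN) : IsProbabilityMeasure (M.chan u) := M.chan_prob u

/-- `G` is a measurable version of the optimal value of the per-slot problem. -/
def Model.IsSlotOptimum (M : Model nR nN) (G : SlotState nR nN → ℝ) : Prop :=
  Measurable G ∧ ∀ z, (∀ j, 0 ≤ z.1.2.1 j) → 0 ≤ z.1.2.2 → (∀ u, 0 ≤ z.2 u) →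
      IsGreatest {v | ∃ dur pow, M.Admissible z.2 dur pow ∧
        M.slotObj z.1.1 z.1.2.1 z.1.2.2 z.2 dur pow = v} (G z)

variable {M : Model nR nN} {G : SlotState nR nN → ℝ}

/-- The optimum is attained by admissible decisions, whose value is dominated by an affine function
of the queue lengths. -/
lemma Model.IsSlotOptimum.integrable (hG : M.IsSlotOptimum G) (E : Realization M) (k : ℕ)
    {Z : E.Ω → (Fin nR → ℝ) × (Fin nN → ℝ) × ℝ} (hZ : Measurable Z)
    (hY : ∀ i ω, 0 ≤ (Z ω).1 i) (hQ : ∀ j ω, 0 ≤ (Z ω).2.1 j) (hX : ∀ ω, 0 ≤ (Z ω).2.2)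
    (hYi : ∀ i, Integrable (fun ω => (Z ω).1 i) E.P)
    (hQi : ∀ j, Integrable (fun ω => (Z ω).2.1 j) E.P)
    (hXi : Integrable (fun ω => (Z ω).2.2) E.P) :
    Integrable (fun ω => G (Z ω, fun u => E.gain k u ω)) E.P := by
  have hdom : Integrable (fun ω => ∑ i, (Z ω).1 i + ∑ j, (Z ω).2.1 j * (M.Ts * M.Rmax) +
      (Z ω).2.2 * M.Pmax) E.P :=
    ((integrable_finsetSum _ fun i _ => hYi i).add
      (integrable_finsetSum _ fun j _ => (hQi j).mul_const _)).add (hXi.mul_const _)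
  refine hdom.mono' (hG.1.comp (hZ.prodMk
    (measurable_pi_lambda _ fun u => E.measurable_gain k u))).aestronglyMeasurable ?_
  filter_upwards [E.gain_bounds k] with ω hω
  obtain ⟨dur, pow, hadm, hval⟩ :=
    (hG.2 (Z ω, fun u => E.gain k u ω) (fun j => hQ j ω) (hX ω) fun u => (hω u).1).1
  rw [← hval, Real.norm_eq_abs]
  exact hadm.abs_slotObj_le hω (fun i => hY i ω) (fun j => hQ j ω) (hX ω)

namespace Policy

variable {E : Realization M} {π : Policy E}

/-- Any policy falls short of the per-slot optimum, for fixed weights `Y, Q, X`. -/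
lemma IsRegular.weighted_le_optimum (h : π.IsRegular) (hG : M.IsSlotOptimum G) (k : ℕ)
    {Y : Fin nR → ℝ} {Q : Fin nN → ℝ} {X : ℝ} (hY : ∀ i, 0 ≤ Y i) (hQ : ∀ j, 0 ≤ Q j)
    (hX : 0 ≤ X) :
    ∑ i, Y i * ∫ ω, π.dur k (Sum.inl i) ω * π.rate k (Sum.inl i) ω / M.L ∂E.P +
      ∑ j, Q j * ∫ ω, π.delivered k j ω ∂E.P - X * ∫ ω, π.slotPower k ω ∂E.P ≤
    ∫ g, G ((Y, Q, X), g) ∂(Measure.pi M.chan) := by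
  have hmeas : Measurable fun ω u => E.gain k u ω :=
    measurable_pi_lambda _ fun u => E.measurable_gain k u
  have hGm : Measurable fun g : User nR nN → ℝ => G ((Y, Q, X), g) :=
    hG.1.comp measurable_prodMk_left
  have i1 : ∀ i, Integrable (fun ω => Y i *
      (π.dur k (Sum.inl i) ω * π.rate k (Sum.inl i) ω / M.L)) E.P := fun i =>
    ((h.integrable_bits k _).div_const _).const_mul _
  have i2 : ∀ j, Integrable (fun ω => Q j * π.delivered k j ω) E.P := fun j =>
    (h.integrable_delivered k j).const_mul _
  have i3 : Integrable (fun ω => X * π.slotPower k ω) E.P := (h.integrable_slotPower k).const_mul _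
  have i4 := integrable_finsetSum Finset.univ fun i _ => i1 i
  have i5 := integrable_finsetSum Finset.univ fun j _ => i2 j
  have i45 : Integrable (fun ω =>
      ∑ i, Y i * (π.dur k (Sum.inl i) ω * π.rate k (Sum.inl i) ω / M.L) +
        ∑ j, Q j * π.delivered k j ω) E.P := i4.add i5
  rw [← E.map_gain k, integral_map hmeas.aemeasurable hGm.aestronglyMeasurable]
  simp_rw [← integral_const_mul]
  rw [← integral_finsetSum _ fun i _ => i1 i, ← integral_finsetSum _ fun j _ => i2 j,
    ← integral_add i4 i5, ← integral_sub i45 i3]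
  refine integral_mono_ae (i45.sub i3)
    (hG.integrable E k measurable_const (fun i _ => hY i) (fun j _ => hQ j) (fun _ => hX)
      (fun i => integrable_const _) (fun j => integrable_const _) (integrable_const _)) ?_
  filter_upwards [h.admissible k, h.rt_bits k, E.gain_bounds k] with ω h1 h2 h3
  -- For almost every outcome the decisions of the slot are admissible for the current gains, hence
  -- a candidate in the per-slot problem with these weights. Delivered bits are at most the bits the
  -- channel carries.
  refine le_trans ?_ ((hG.2 ((Y, Q, X), fun u => E.gain k u ω) hQ hX fun u => (h3 u).1).2
    ⟨_, _, h1, rfl⟩)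
  refine sub_le_sub_right (add_le_add (le_of_eq ?_) (Finset.sum_le_sum fun j _ => ?_)) _
  · exact Finset.sum_congr rfl fun i _ => by rw [h2 i]
  · exact mul_le_mul_of_nonneg_left (min_le_left _ _) (hQ j)

/-- Delivered bits are admitted bits minus the final queue, and admissions are bounded by arrivals.
The upper bound `L λ` on delivery rates is needed later in the drift estimate. -/
lemma IsRegular.timeAvg_delivered_mem (h : π.IsRegular) (K : ℕ) (j : Fin nN) :
    timeAvg (fun k => ∫ ω, π.delivered k j ω ∂E.P) K ∈
      Set.Icc 0 (M.L * M.lam (Sum.inr j)) := by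
  have hL := M.L_pos
  have hlam := (M.lam_mem (Sum.inr j)).1
  constructor
  · exact div_nonneg (Finset.sum_nonneg fun k _ =>
      integral_nonneg_of_ae ((h.delivered_mem k).mono fun ω h1 => (h1 j).1)) (Nat.cast_nonneg _)
  · refine div_le_of_le_mul₀ (Nat.cast_nonneg _) (by positivity) ?_
    rw [h.sum_integral_delivered]
    have hQ : 0 ≤ ∫ ω, π.Q K j ω ∂E.P := integral_nonneg fun ω => π.Q_nonneg K j ω
    have hadm : ∀ k, ∫ ω, π.adm k j ω ∂E.P ≤ M.lam (Sum.inr j) := fun k => by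
      rw [← E.integral_arr k]
      exact integral_mono_ae (h.integrable_adm k j) (E.integrable_arr k _)
        ((h.admission k).mono fun ω h1 => (h1 j).2)
    have : ∑ k ∈ Finset.range K, M.L * ∫ ω, π.adm k j ω ∂E.P ≤
        ∑ k ∈ Finset.range K, M.L * M.lam (Sum.inr j) :=
      Finset.sum_le_sum fun k _ => mul_le_mul_of_nonneg_left (hadm k) hL.le
    rw [Finset.sum_const, Finset.card_range, nsmul_eq_mul] at this
    linarith

lemma timeAvg_mem_Icc {f : ℕ → ℝ} {a b : ℝ} (ha : a ≤ 0) (hb : 0 ≤ b) (hf : ∀ k, f k ∈ Set.Icc a b)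
    (K : ℕ) : timeAvg f K ∈ Set.Icc a b := by
  rw [timeAvg]
  rcases Nat.eq_zero_or_pos K with rfl | hK
  · simpa using ⟨ha, hb⟩
  have hK' : (0 : ℝ) < K := Nat.cast_pos.2 hK
  have h1 := Finset.card_nsmul_le_sum (Finset.range K) f a fun k _ => (hf k).1
  have h2 := Finset.sum_le_card_nsmul (Finset.range K) f b fun k _ => (hf k).2
  rw [Finset.card_range, nsmul_eq_mul] at h1 h2
  exact ⟨by rw [le_div_iff₀ hK']; linarith, by rw [div_le_iff₀ hK']; linarith⟩

lemma IsRegular.timeAvg_slotPower_mem (h : π.IsRegular) (K : ℕ) :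
    timeAvg (fun k => ∫ ω, π.slotPower k ω ∂E.P) K ∈ Set.Icc 0 M.Pmax := by
  refine timeAvg_mem_Icc le_rfl M.Pmax_pos.le (fun k => ⟨?_, ?_⟩) K
  · exact integral_nonneg_of_ae ((h.slotPower_mem k).mono fun ω h1 => h1.1)
  · simpa using integral_mono_ae (h.integrable_slotPower k) (integrable_const M.Pmax)
      ((h.slotPower_mem k).mono fun ω h1 => h1.2)

lemma IsRegular.timeAvg_rt_mem (h : π.IsRegular) (i : Fin nR) (K : ℕ) :
    timeAvg (fun k => ∫ ω, π.dur k (Sum.inl i) ω * π.rate k (Sum.inl i) ω / M.L ∂E.P) K ∈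
      Set.Icc 0 1 := by
  have hmem : ∀ k, ∀ᵐ ω ∂E.P, 0 ≤ π.dur k (Sum.inl i) ω * π.rate k (Sum.inl i) ω / M.L ∧
      π.dur k (Sum.inl i) ω * π.rate k (Sum.inl i) ω / M.L ≤ 1 := fun k => by
    filter_upwards [h.rt_bits k] with ω h1
    rw [h1 i]
    split_ifs <;> norm_num
  refine timeAvg_mem_Icc le_rfl zero_le_one (fun k => ⟨?_, ?_⟩) K
  · exact integral_nonneg_of_ae ((hmem k).mono fun ω h1 => h1.1)
  · simpa using integral_mono_ae ((h.integrable_bits k _).div_const M.L) (integrable_const (1 : ℝ))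
      ((hmem k).mono fun ω h1 => h1.2)

lemma IsRegular.timeAvg_throughput (h : π.IsRegular) (K : ℕ) :
    timeAvg (fun k => ∫ ω, (∑ j, π.delivered k j ω) / M.L ∂E.P) K =
      (∑ j, timeAvg (fun k => ∫ ω, π.delivered k j ω ∂E.P) K) / M.L := by
  have e : ∀ k, ∫ ω, (∑ j, π.delivered k j ω) / M.L ∂E.P =
      (∑ j, ∫ ω, π.delivered k j ω ∂E.P) / M.L := fun k => by
    rw [integral_div, integral_finsetSum _ fun j _ => h.integrable_delivered k j]
  simp only [timeAvg, e]
  rw [← Finset.sum_div, Finset.sum_comm, ← Finset.sum_div]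
  ring

lemma IsRegular.timeAvg_throughput_mem (h : π.IsRegular) (K : ℕ) :
    timeAvg (fun k => ∫ ω, (∑ j, π.delivered k j ω) / M.L ∂E.P) K ∈ Set.Icc (0 : ℝ) nN := by
  have hL := M.L_pos
  rw [h.timeAvg_throughput]
  have h1 := fun j => h.timeAvg_delivered_mem K j
  constructor
  · exact div_nonneg (Finset.sum_nonneg fun j _ => (h1 j).1) hL.le
  · rw [div_le_iff₀ hL]
    have : ∑ j, timeAvg (fun k => ∫ ω, π.delivered k j ω ∂E.P) K ≤ ∑ _j : Fin nN, M.L :=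
      Finset.sum_le_sum fun j _ => (h1 j).2.trans
        (mul_le_of_le_one_right hL.le (M.lam_mem _).2)
    simpa using this

lemma IsRegular.throughput_le (h : π.IsRegular) : π.throughput ≤ nN :=
  liminf_le_of_frequently_le
    (Eventually.of_forall fun K => (h.timeAvg_throughput_mem K).2).frequently
    (isBoundedUnder_of ⟨0, fun K => (h.timeAvg_throughput_mem K).1⟩)

/-- Long-run delivery rates `d` of a feasible policy: for all weights, the per-slot optimum is at
least what these rates, the QoS targets and the power budget are worth. -/
theorem IsFeasible.exists_rates (h : π.IsFeasible) (hG : M.IsSlotOptimum G) :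
    ∃ d : Fin nN → ℝ, (∀ j, 0 ≤ d j ∧ d j ≤ M.L * M.lam (Sum.inr j)) ∧
      M.L * π.throughput ≤ ∑ j, d j ∧
      ∀ (Y : Fin nR → ℝ) (Q : Fin nN → ℝ) (X : ℝ), (∀ i, 0 ≤ Y i) → (∀ j, 0 ≤ Q j) → 0 ≤ X →
        ∑ i, Y i * (M.lam (Sum.inl i) * M.q i) + ∑ j, Q j * d j - X * M.Pavg ≤
          ∫ g, G ((Y, Q, X), g) ∂(Measure.pi M.chan) := by
  have hr := h.isRegular
  have hL := M.L_pos
  set D : ℕ → Fin nN → ℝ := fun K j => timeAvg (fun k => ∫ ω, π.delivered k j ω ∂E.P) K with hD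
  -- The individual delivery averages need not converge, so `d` is a limit along one subsequence
  -- common to all NRT users. The lower bounds from the liminf and the upper bound from the limsup
  -- hold along the whole sequence up to `ε`, hence also along this one.
  obtain ⟨d, hd, φ, hφ, hlim⟩ := (isCompact_univ_pi fun j =>
    isCompact_Icc (a := (0 : ℝ)) (b := M.L * M.lam (Sum.inr j))).tendsto_subseq
      (x := D) fun K j _ => hr.timeAvg_delivered_mem K j
  have hlimj : ∀ j, Tendsto (fun n => D (φ n) j) atTop (nhds (d j)) := fun j =>
    (tendsto_pi_nhds.1 hlim) j
  refine ⟨d, fun j => hd j trivial, ?_, fun Y Q X hY hQ hX => ?_⟩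
  · have hlt : ∀ ε > 0, π.throughput - ε ≤ (∑ j, d j) / M.L := fun ε hε => by
      have hev : ∀ᶠ K in atTop, π.throughput - ε < (∑ j, D K j) / M.L := by
        have := eventually_lt_of_lt_liminf (f := atTop)
          (u := timeAvg fun k => ∫ ω, (∑ j, π.delivered k j ω) / M.L ∂E.P)
          (show π.throughput - ε < π.throughput by linarith)
          (isBoundedUnder_of ⟨0, fun K => (hr.timeAvg_throughput_mem K).1⟩)
        simpa only [hr.timeAvg_throughput] using this
      exact ge_of_tendsto ((tendsto_finsetSum _ fun j _ => hlimj j).div_const M.L)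
        ((hφ.tendsto_atTop.eventually hev).mono fun _ h => h.le)
    have : π.throughput ≤ (∑ j, d j) / M.L :=
      le_of_forall_pos_le_add fun ε hε => by linarith [hlt ε hε]
    rwa [le_div_iff₀ hL, mul_comm] at this
  · set b := ∫ g, G ((Y, Q, X), g) ∂(Measure.pi M.chan)
    set R : ℕ → Fin nR → ℝ := fun K i =>
      timeAvg (fun k => ∫ ω, π.dur k (Sum.inl i) ω * π.rate k (Sum.inl i) ω / M.L ∂E.P) K
    set P : ℕ → ℝ := timeAvg fun k => ∫ ω, π.slotPower k ω ∂E.P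
    -- The weights are fixed, so the bound of each slot can be averaged over the first `K` slots.
    have havg : ∀ K, 0 < K → ∑ i, Y i * R K i + ∑ j, Q j * D K j - X * P K ≤ b := fun K hK => by
      have hK' : (0 : ℝ) < K := Nat.cast_pos.2 hK
      have hs := Finset.sum_le_card_nsmul (Finset.range K) _ b
        fun k _ => hr.weighted_le_optimum hG k hY hQ hX
      rw [Finset.card_range, nsmul_eq_mul, Finset.sum_sub_distrib, Finset.sum_add_distrib,
        Finset.sum_comm, Finset.sum_comm (s := Finset.range K)] at hs
      simp_rw [← Finset.mul_sum] at hs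
      simp only [R, D, P, timeAvg, ← mul_div_assoc, ← Finset.sum_div]
      rw [← add_div, ← sub_div, div_le_iff₀' hK']
      exact hs
    have hε : ∀ ε > 0, ∑ i, Y i * (M.lam (Sum.inl i) * M.q i - ε) + ∑ j, Q j * d j -
        X * (M.Pavg + ε) ≤ b := fun ε hε => by
      have h1 : ∀ᶠ K in atTop, ∀ i, M.lam (Sum.inl i) * M.q i - ε < R K i :=
        eventually_all.2 fun i => eventually_lt_of_lt_liminf (by
          have := h.qos i
          rw [rtRate] at this
          exact lt_of_lt_of_le (by linarith) this)
          (isBoundedUnder_of ⟨0, fun K => (hr.timeAvg_rt_mem i K).1⟩)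
      have h2 : ∀ᶠ K in atTop, P K < M.Pavg + ε := eventually_lt_of_limsup_lt
        (lt_of_le_of_lt h.avgPower (by linarith))
        (isBoundedUnder_of ⟨M.Pmax, fun K => (hr.timeAvg_slotPower_mem K).2⟩)
      have h3 : ∀ᶠ K in atTop, ∑ i, Y i * (M.lam (Sum.inl i) * M.q i - ε) + ∑ j, Q j * D K j -
          X * (M.Pavg + ε) ≤ b := by
        filter_upwards [h1, h2, eventually_gt_atTop 0] with K h1 h2 h3
        have h4 := havg K h3
        have h5 : ∑ i, Y i * (M.lam (Sum.inl i) * M.q i - ε) ≤ ∑ i, Y i * R K i :=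
          Finset.sum_le_sum fun i _ => mul_le_mul_of_nonneg_left (h1 i).le (hY i)
        have h6 := mul_le_mul_of_nonneg_left h2.le hX
        linarith
      exact le_of_tendsto (((tendsto_finsetSum _ fun j _ => (hlimj j).const_mul (Q j)).const_add
        _).sub_const _) (hφ.tendsto_atTop.eventually h3)
    have hcont : Tendsto (fun ε : ℝ => ∑ i, Y i * (M.lam (Sum.inl i) * M.q i - ε) +
        ∑ j, Q j * d j - X * (M.Pavg + ε)) (nhdsWithin 0 (Set.Ioi 0))
        (nhds (∑ i, Y i * (M.lam (Sum.inl i) * M.q i - 0) +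
        ∑ j, Q j * d j - X * (M.Pavg + 0))) :=
      Continuous.tendsto (by fun_prop) 0 |>.mono_left nhdsWithin_le_nhds
    simp only [sub_zero, add_zero] at hcont
    exact le_of_tendsto hcont (by filter_upwards [self_mem_nhdsWithin] with ε h; exact hε ε h)

end Policy

/-! ### Lyapunov drift -/

/-- Taking the positive part does not increase the square, and the cross term `-2 α β` is dropped.
-/
lemma sq_max_add_sub_le {x α β : ℝ} (hα : 0 ≤ α) (hβ : 0 ≤ β) :
    max (x + α - β) 0 ^ 2 ≤ x ^ 2 + 2 * (x * α - x * β) + (α ^ 2 + β ^ 2) := by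
  have h : max (x + α - β) 0 ^ 2 ≤ (x + α - β) ^ 2 := by
    rcases le_total (x + α - β) 0 with h | h
    · rw [max_eq_right h]; simpa using sq_nonneg (x + α - β)
    · rw [max_eq_left h]
  nlinarith [mul_nonneg hα hβ]

namespace Policy

variable {E : Realization M} {π : Policy E}

/-- The quadratic Lyapunov function of the queues. -/
def lyapunov (π : Policy E) (k : ℕ) (ω : E.Ω) : ℝ :=
  (∑ i, π.Y k i ω ^ 2 + ∑ j, π.Q k j ω ^ 2 + π.X k ω ^ 2) / 2

/-- The per-slot objective that the policy attains in slot `k`. -/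
def slotValue (π : Policy E) (k : ℕ) (ω : E.Ω) : ℝ :=
  M.slotObj (fun i => π.Y k i ω) (fun j => π.Q k j ω) (π.X k ω) (fun u => E.gain k u ω)
    (fun u => π.dur k u ω) (fun u => π.pow k u ω)

lemma IsRegular.lyapunov_succ_le (h : π.IsRegular) (k : ℕ) : ∀ᵐ ω ∂E.P,
    π.lyapunov (k + 1) ω ≤ π.lyapunov k ω + M.C₁ / 2 +
      ∑ i, π.Y k i ω * (E.arr k (Sum.inl i) ω * M.q i) +
      ∑ j, π.Q k j ω * (M.L * π.adm k j ω) - π.X k ω * M.Pavg - π.slotValue k ω := by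
  have hL := M.L_pos
  filter_upwards [h.adm_mem k, h.bits_mem k, h.slotPower_mem k] with ω h1 h2 h3
  have hY : ∀ i, π.Y (k + 1) i ω ^ 2 ≤ π.Y k i ω ^ 2 +
      2 * (π.Y k i ω * (E.arr k (Sum.inl i) ω * M.q i) -
        π.Y k i ω * (if π.dur k (Sum.inl i) ω = 0 then 0 else 1)) + (M.q i ^ 2 + 1) := fun i => by
    have ha := E.arr_bounds k (Sum.inl i) ω
    have hq := M.q_mem i
    have h0 : 0 ≤ E.arr k (Sum.inl i) ω * M.q i := mul_nonneg ha.1 hq.1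
    have h1' : (0 : ℝ) ≤ if π.dur k (Sum.inl i) ω = 0 then 0 else 1 := by split_ifs <;> norm_num
    refine (sq_max_add_sub_le h0 h1').trans (add_le_add_right (add_le_add ?_ ?_) _)
    · exact pow_le_pow_left₀ h0 (mul_le_of_le_one_left hq.1 ha.2) 2
    · split_ifs <;> norm_num
  have hQ : ∀ j, π.Q (k + 1) j ω ^ 2 ≤ π.Q k j ω ^ 2 +
      2 * (π.Q k j ω * (M.L * π.adm k j ω) -
        π.Q k j ω * (π.dur k (Sum.inr j) ω * π.rate k (Sum.inr j) ω)) +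
        (M.L ^ 2 + (M.Ts * M.Rmax) ^ 2) := fun j => by
    have h0 : 0 ≤ M.L * π.adm k j ω := mul_nonneg hL.le (h1 j).1
    refine (sq_max_add_sub_le h0 (h2 (Sum.inr j)).1).trans
      (add_le_add_right (add_le_add ?_ ?_) _)
    · exact pow_le_pow_left₀ h0 (mul_le_of_le_one_right hL.le (h1 j).2) 2
    · exact pow_le_pow_left₀ (h2 _).1 (h2 _).2 2
  have hX : π.X (k + 1) ω ^ 2 ≤ π.X k ω ^ 2 +
      2 * (π.X k ω * π.slotPower k ω - π.X k ω * M.Pavg) + (M.Pmax ^ 2 + M.Pavg ^ 2) :=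
    (sq_max_add_sub_le h3.1 M.Pavg_pos.le).trans
      (add_le_add_right (add_le_add (pow_le_pow_left₀ h3.1 h3.2 2) le_rfl) _)
  have hYs := Finset.sum_le_sum fun i (_ : i ∈ Finset.univ) => hY i
  have hQs := Finset.sum_le_sum fun j (_ : j ∈ Finset.univ) => hQ j
  rw [Finset.sum_add_distrib, Finset.sum_add_distrib, ← Finset.mul_sum,
    Finset.sum_sub_distrib] at hYs hQs
  rw [Finset.sum_const, Finset.card_univ, Fintype.card_fin, nsmul_eq_mul] at hQs
  -- `C₁` collects `α² + β²` over all queues, bounding input and output by `q` and `1` for `Y`, by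
  -- `L` and `Ts Rmax` for `Q`, and by `Pmax` and `Pavg` for `X`.
  have hC : M.C₁ = ∑ i, (M.q i ^ 2 + 1) + nN * (M.L ^ 2 + (M.Ts * M.Rmax) ^ 2) +
      (M.Pmax ^ 2 + M.Pavg ^ 2) := by
    rw [Model.C₁]; ring
  have hS : π.slotValue k ω = ∑ i, π.Y k i ω * (if π.dur k (Sum.inl i) ω = 0 then 0 else 1) +
      ∑ j, π.Q k j ω * (π.dur k (Sum.inr j) ω * π.rate k (Sum.inr j) ω) -
      π.X k ω * π.slotPower k ω := rfl
  rw [lyapunov, lyapunov, hS, hC]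
  linarith

lemma IsRegular.integrable_sq_Y (_h : π.IsRegular) (k : ℕ) (i : Fin nR) :
    Integrable (fun ω => π.Y k i ω ^ 2) E.P :=
  Integrable.of_mem_Icc 0 ((k : ℝ) ^ 2) ((π.measurable_Y k i).pow_const 2).aemeasurable
    (Eventually.of_forall fun ω =>
      ⟨sq_nonneg _, pow_le_pow_left₀ (π.Y_nonneg k i ω) (π.Y_le k i ω) 2⟩)

lemma IsRegular.integrable_sq_Q (h : π.IsRegular) (k : ℕ) (j : Fin nN) :
    Integrable (fun ω => π.Q k j ω ^ 2) E.P :=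
  Integrable.of_mem_Icc 0 ((k * M.L) ^ 2) ((π.measurable_Q k j).pow_const 2).aemeasurable
    ((h.Q_le k).mono fun ω h1 =>
      ⟨sq_nonneg _, pow_le_pow_left₀ (π.Q_nonneg k j ω) (h1 j) 2⟩)

lemma IsRegular.integrable_sq_X (h : π.IsRegular) (k : ℕ) :
    Integrable (fun ω => π.X k ω ^ 2) E.P :=
  Integrable.of_mem_Icc 0 ((k * M.Pmax) ^ 2) ((π.measurable_X k).pow_const 2).aemeasurable
    ((h.X_le k).mono fun ω h1 =>
      ⟨sq_nonneg _, pow_le_pow_left₀ (π.X_nonneg k ω) h1 2⟩)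

lemma IsRegular.integrable_lyapunov (h : π.IsRegular) (k : ℕ) :
    Integrable (π.lyapunov k) E.P :=
  (((integrable_finsetSum _ fun i _ => h.integrable_sq_Y k i).add
    (integrable_finsetSum _ fun j _ => h.integrable_sq_Q k j)).add (h.integrable_sq_X k)).div_const 2

lemma IsRegular.integrable_optimum (h : π.IsRegular) (hG : M.IsSlotOptimum G) (k : ℕ) :
    Integrable (fun ω => G (π.queues k ω, fun u => E.gain k u ω)) E.P :=
  hG.integrable E k (π.measurable_queues k) (fun i ω => π.Y_nonneg k i ω)
    (fun j ω => π.Q_nonneg k j ω) (fun ω => π.X_nonneg k ω) (π.integrable_Y k)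
    (h.integrable_Q k) (h.integrable_X k)

/-- The current gains are independent of the queues, so that the per-slot optimum can be
integrated over the gains first. -/
lemma IsRegular.integral_optimum_ge (h : π.IsRegular) (hG : M.IsSlotOptimum G) {d : Fin nN → ℝ}
    (hd : ∀ (Y : Fin nR → ℝ) (Q : Fin nN → ℝ) (X : ℝ), (∀ i, 0 ≤ Y i) → (∀ j, 0 ≤ Q j) → 0 ≤ X →
        ∑ i, Y i * (M.lam (Sum.inl i) * M.q i) + ∑ j, Q j * d j - X * M.Pavg ≤
          ∫ g, G ((Y, Q, X), g) ∂(Measure.pi M.chan)) (k : ℕ) :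
    ∑ i, (∫ ω, π.Y k i ω ∂E.P) * (M.lam (Sum.inl i) * M.q i) +
      ∑ j, (∫ ω, π.Q k j ω ∂E.P) * d j - (∫ ω, π.X k ω ∂E.P) * M.Pavg ≤
    ∫ ω, G (π.queues k ω, fun u => E.gain k u ω) ∂E.P := by
  have hgm : Measurable fun ω u => E.gain k u ω :=
    measurable_pi_lambda _ fun u => E.measurable_gain k u
  have hqm := π.measurable_queues k
  have hind : IndepFun (π.queues k) (fun ω u => E.gain k u ω) E.P :=
    (π.indepFun_queues k).comp (φ := id)
      (ψ := fun (x : User nR nN → ℝ × ℝ) u => (x u).1) measurable_id (by fun_prop)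
  have hlaw := (indepFun_iff_map_prod_eq_prod_map_map hqm.aemeasurable hgm.aemeasurable).1 hind
  rw [E.map_gain k] at hlaw
  have hprob : IsProbabilityMeasure (E.P.map (π.queues k)) :=
    Measure.isProbabilityMeasure_map hqm.aemeasurable
  have hint : Integrable G ((E.P.map (π.queues k)).prod (Measure.pi M.chan)) := by
    rw [← hlaw, integrable_map_measure hG.1.aestronglyMeasurable (hqm.prodMk hgm).aemeasurable]
    exact h.integrable_optimum hG k
  -- Fubini for the product law of queues and gains; the inner integral is then the quantity bounded
  -- by `hd`, with the queues frozen.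
  have e1 : ∫ ω, G (π.queues k ω, fun u => E.gain k u ω) ∂E.P =
      ∫ ω, ∫ g, G (π.queues k ω, g) ∂(Measure.pi M.chan) ∂E.P := by
    rw [← integral_map (φ := fun ω => (π.queues k ω, fun u => E.gain k u ω))
      (hqm.prodMk hgm).aemeasurable hG.1.aestronglyMeasurable, hlaw, integral_prod _ hint,
      integral_map hqm.aemeasurable hint.integral_prod_left.aestronglyMeasurable]
  have hint' : Integrable (fun ω => ∫ g, G (π.queues k ω, g) ∂(Measure.pi M.chan)) E.P :=
    hint.integral_prod_left.comp_measurable hqm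
  have i1 := integrable_finsetSum Finset.univ fun i (_ : i ∈ Finset.univ) =>
    (π.integrable_Y k i).mul_const (M.lam (Sum.inl i) * M.q i)
  have i2 := integrable_finsetSum Finset.univ fun j (_ : j ∈ Finset.univ) =>
    (h.integrable_Q k j).mul_const (d j)
  have i3 := (h.integrable_X k).mul_const M.Pavg
  have i12 : Integrable (fun ω => ∑ i, π.Y k i ω * (M.lam (Sum.inl i) * M.q i) +
    ∑ j, π.Q k j ω * d j) E.P := i1.add i2
  have e2 : ∫ ω, (∑ i, π.Y k i ω * (M.lam (Sum.inl i) * M.q i) + ∑ j, π.Q k j ω * d j -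
      π.X k ω * M.Pavg) ∂E.P = ∑ i, (∫ ω, π.Y k i ω ∂E.P) * (M.lam (Sum.inl i) * M.q i) +
      ∑ j, (∫ ω, π.Q k j ω ∂E.P) * d j - (∫ ω, π.X k ω ∂E.P) * M.Pavg := by
    rw [integral_sub i12 i3, integral_add i1 i2,
      integral_finsetSum _ fun i _ => (π.integrable_Y k i).mul_const _,
      integral_finsetSum _ fun j _ => (h.integrable_Q k j).mul_const _]
    simp_rw [integral_mul_const]
  rw [← e2, e1]
  exact integral_mono (i12.sub i3) hint' fun ω => hd _ _ _ (fun i => π.Y_nonneg k i ω)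
    (fun j => π.Q_nonneg k j ω) (π.X_nonneg k ω)

lemma IsLambertStrict.slotValue_ge {B : ℝ} (h : π.IsLambertStrict B) (hG : M.IsSlotOptimum G)
    (k : ℕ) : ∀ᵐ ω ∂E.P, G (π.queues k ω, fun u => E.gain k u ω) ≤ π.slotValue k ω := by
  filter_upwards [h k, E.gain_bounds k] with ω h1 h2
  obtain ⟨dur, pow, hadm, hval⟩ := (hG.2 (π.queues k ω, fun u => E.gain k u ω)
    (fun j => π.Q_nonneg k j ω) (π.X_nonneg k ω) fun u => (h2 u).1).1
  rw [← hval]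
  exact h1.slotObj_le (fun j => π.Q_nonneg k j ω) (π.X_nonneg k ω) (fun u => (h2 u).1) hadm

lemma integral_Y_mul_arr (π : Policy E) (k : ℕ) (i : Fin nR) :
    Integrable (fun ω => π.Y k i ω * E.arr k (Sum.inl i) ω) E.P ∧
    ∫ ω, π.Y k i ω * E.arr k (Sum.inl i) ω ∂E.P =
      (∫ ω, π.Y k i ω ∂E.P) * M.lam (Sum.inl i) := by
  have hind : IndepFun (π.Y k i) (E.arr k (Sum.inl i)) E.P :=
    (π.indepFun_queues k).comp (φ := fun z : (Fin nR → ℝ) × (Fin nN → ℝ) × ℝ => z.1 i)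
      (ψ := fun x : User nR nN → ℝ × ℝ => (x (Sum.inl i)).2)
      (by fun_prop) (by fun_prop)
  refine ⟨hind.integrable_mul (π.integrable_Y k i) (E.integrable_arr k _), ?_⟩
  rw [← E.integral_arr k, ← hind.integral_fun_mul_eq_mul_integral
    (π.measurable_Y k i).aestronglyMeasurable (E.measurable_arr k _).aestronglyMeasurable]

lemma IsRegular.integrable_slack (h : π.IsRegular) (B : ℝ) (k : ℕ) (j : Fin nN) :
    Integrable (fun ω => max (B - π.Q k j ω) 0) E.P :=
  ((integrable_const B).sub (h.integrable_Q k j)).pos_part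

lemma IsRegular.integral_slack_mul_arr (h : π.IsRegular) (B : ℝ) (k : ℕ) (j : Fin nN) :
    Integrable (fun ω => max (B - π.Q k j ω) 0 * E.arr k (Sum.inr j) ω) E.P ∧
    ∫ ω, max (B - π.Q k j ω) 0 * E.arr k (Sum.inr j) ω ∂E.P =
      (∫ ω, max (B - π.Q k j ω) 0 ∂E.P) * M.lam (Sum.inr j) := by
  have hind : IndepFun (fun ω => max (B - π.Q k j ω) 0) (E.arr k (Sum.inr j)) E.P :=
    (π.indepFun_queues k).comp (φ := fun z : (Fin nR → ℝ) × (Fin nN → ℝ) × ℝ => max (B - z.2.1 j) 0)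

      (ψ := fun x : User nR nN → ℝ × ℝ => (x (Sum.inr j)).2) (by fun_prop) (by fun_prop)
  refine ⟨hind.integrable_mul (h.integrable_slack B k j) (E.integrable_arr k _), ?_⟩
  rw [← E.integral_arr k, ← hind.integral_fun_mul_eq_mul_integral
    (h.integrable_slack B k j).aestronglyMeasurable (E.measurable_arr k _).aestronglyMeasurable]

/-- Drift plus penalty of the algorithm in one slot. -/
theorem IsLambertStrict.integral_lyapunov_succ_le {B : ℝ} (h : π.IsLambertStrict B)
    (hG : M.IsSlotOptimum G) {d : Fin nN → ℝ}
    (hd0 : ∀ j, 0 ≤ d j ∧ d j ≤ M.L * M.lam (Sum.inr j))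
    (hd : ∀ (Y : Fin nR → ℝ) (Q : Fin nN → ℝ) (X : ℝ), (∀ i, 0 ≤ Y i) → (∀ j, 0 ≤ Q j) → 0 ≤ X →
        ∑ i, Y i * (M.lam (Sum.inl i) * M.q i) + ∑ j, Q j * d j - X * M.Pavg ≤
          ∫ g, G ((Y, Q, X), g) ∂(Measure.pi M.chan)) (k : ℕ) :
    ∫ ω, π.lyapunov (k + 1) ω ∂E.P + B * ∑ j, d j ≤ ∫ ω, π.lyapunov k ω ∂E.P + M.C₁ / 2 +
      B * ∑ j, M.L * ∫ ω, π.adm k j ω ∂E.P := by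
  have hr := h.isRegular
  have i1 : Integrable (fun ω => π.lyapunov k ω + M.C₁ / 2) E.P :=
    (hr.integrable_lyapunov k).add (integrable_const _)
  have i2 := integrable_finsetSum Finset.univ fun i (_ : i ∈ Finset.univ) =>
    (π.integral_Y_mul_arr k i).1.mul_const (M.q i)
  have i3 := integrable_finsetSum Finset.univ fun j (_ : j ∈ Finset.univ) =>
    (hr.integrable_adm k j).const_mul (B * M.L)
  have i4 := integrable_finsetSum Finset.univ fun j (_ : j ∈ Finset.univ) =>
    (hr.integral_slack_mul_arr B k j).1.const_mul M.L
  have i5 := (hr.integrable_X k).mul_const M.Pavg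
  have i6 := hr.integrable_optimum hG k
  have i12 : Integrable (fun ω => π.lyapunov k ω + M.C₁ / 2 +
      ∑ i, π.Y k i ω * E.arr k (Sum.inl i) ω * M.q i) E.P := i1.add i2
  have i123 : Integrable (fun ω => π.lyapunov k ω + M.C₁ / 2 +
      ∑ i, π.Y k i ω * E.arr k (Sum.inl i) ω * M.q i +
      ∑ j, B * M.L * π.adm k j ω) E.P := i12.add i3
  have i1234 : Integrable (fun ω => π.lyapunov k ω + M.C₁ / 2 +
      ∑ i, π.Y k i ω * E.arr k (Sum.inl i) ω * M.q i +
      ∑ j, B * M.L * π.adm k j ω -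
      ∑ j, M.L * (max (B - π.Q k j ω) 0 * E.arr k (Sum.inr j) ω)) E.P := i123.sub i4
  have i12345 : Integrable (fun ω => π.lyapunov k ω + M.C₁ / 2 +
      ∑ i, π.Y k i ω * E.arr k (Sum.inl i) ω * M.q i +
      ∑ j, B * M.L * π.adm k j ω -
      ∑ j, M.L * (max (B - π.Q k j ω) 0 * E.arr k (Sum.inr j) ω) - π.X k ω * M.Pavg) E.P :=
    i1234.sub i5
  have hle : ∫ ω, π.lyapunov (k + 1) ω ∂E.P ≤ ∫ ω, (π.lyapunov k ω + M.C₁ / 2 +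
      ∑ i, π.Y k i ω * E.arr k (Sum.inl i) ω * M.q i +
      ∑ j, B * M.L * π.adm k j ω -
      ∑ j, M.L * (max (B - π.Q k j ω) 0 * E.arr k (Sum.inr j) ω) - π.X k ω * M.Pavg -
      G (π.queues k ω, fun u => E.gain k u ω)) ∂E.P := by
    refine integral_mono_ae (hr.integrable_lyapunov _) (i12345.sub i6) ?_
    filter_upwards [h k, hr.lyapunov_succ_le k, h.slotValue_ge hG k] with ω h1 h2 h3
    have e1 : ∑ i, π.Y k i ω * (E.arr k (Sum.inl i) ω * M.q i) =
        ∑ i, π.Y k i ω * E.arr k (Sum.inl i) ω * M.q i :=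
      Finset.sum_congr rfl fun i _ => (mul_assoc _ _ _).symm
    -- The threshold rule gives `(B - Q) r = (B - Q)⁺ a`: a packet is admitted exactly when doing so
    -- has positive weight.
    have e2 : ∑ j, π.Q k j ω * (M.L * π.adm k j ω) = ∑ j, B * M.L * π.adm k j ω -
        ∑ j, M.L * (max (B - π.Q k j ω) 0 * E.arr k (Sum.inr j) ω) := by
      rw [← Finset.sum_sub_distrib]
      refine Finset.sum_congr rfl fun j _ => ?_
      have hadm : π.adm k j ω = if π.Q k j ω < B then E.arr k (Sum.inr j) ω else 0 := h1.1 j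
      rw [hadm]
      split_ifs with hQ
      · rw [max_eq_left (by linarith)]; ring
      · rw [max_eq_right (by linarith)]; ring
    rw [e1, e2] at h2
    linarith
  rw [integral_sub i12345 i6, integral_sub i1234 i5, integral_sub i123 i4, integral_add i12 i3,
    integral_add i1 i2, integral_add (hr.integrable_lyapunov k) (integrable_const _),
    integral_finsetSum _ fun i _ => (π.integral_Y_mul_arr k i).1.mul_const (M.q i),
    integral_finsetSum _ fun j _ => (hr.integrable_adm k j).const_mul (B * M.L),
    integral_finsetSum _ fun j _ => (hr.integral_slack_mul_arr B k j).1.const_mul M.L] at hle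
  simp only [integral_mul_const, integral_const_mul, (π.integral_Y_mul_arr k _).2,
    (hr.integral_slack_mul_arr B k _).2, integral_const, probReal_univ, one_smul] at hle
  have hopt := hr.integral_optimum_ge hG hd k
  -- From `d ≤ L λ` and `(B - Q)⁺ ≥ B - Q` follows `L λ E (B - Q)⁺ + d E Q ≥ d E (B - Q) + d E Q = B
  -- d`.
  have hslack : B * ∑ j, d j ≤
      ∑ j, M.L * ((∫ ω, max (B - π.Q k j ω) 0 ∂E.P) * M.lam (Sum.inr j)) +
        ∑ j, (∫ ω, π.Q k j ω ∂E.P) * d j := by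
    rw [Finset.mul_sum, ← Finset.sum_add_distrib]
    refine Finset.sum_le_sum fun j _ => ?_
    have h0 : 0 ≤ ∫ ω, max (B - π.Q k j ω) 0 ∂E.P := integral_nonneg fun ω => le_max_right _ _
    have h1 : B - ∫ ω, π.Q k j ω ∂E.P ≤ ∫ ω, max (B - π.Q k j ω) 0 ∂E.P := by
      have e : ∫ ω, (B - π.Q k j ω) ∂E.P = B - ∫ ω, π.Q k j ω ∂E.P := by
        rw [integral_sub (integrable_const _) (hr.integrable_Q k j)]
        simp
      rw [← e]
      exact integral_mono ((integrable_const _).sub (hr.integrable_Q k j))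
        (hr.integrable_slack B k j) fun ω => le_max_left _ _
    have h2 := mul_le_mul_of_nonneg_left (hd0 j).2 h0
    have h3 := mul_le_mul_of_nonneg_right h1 (hd0 j).1
    linarith
  have e3 : ∑ i, (∫ ω, π.Y k i ω ∂E.P) * M.lam (Sum.inl i) * M.q i =
      ∑ i, (∫ ω, π.Y k i ω ∂E.P) * (M.lam (Sum.inl i) * M.q i) :=
    Finset.sum_congr rfl fun i _ => mul_assoc _ _ _
  have e4 : ∑ j, B * M.L * ∫ ω, π.adm k j ω ∂E.P = B * ∑ j, M.L * ∫ ω, π.adm k j ω ∂E.P := by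
    rw [Finset.mul_sum]
    exact Finset.sum_congr rfl fun j _ => mul_assoc _ _ _
  linarith

end Policy

/-! ### Existence of the policy -/

/-- The queues at the end of a slot in which the decisions are `dur`, `pow` and those of the
admission rule with threshold `B`. -/
def Model.nextQueues (M : Model nR nN) (dur pow : SlotState nR nN → User nR nN → ℝ) (B : ℝ)
    (z : SlotState nR nN) (a : User nR nN → ℝ) : (Fin nR → ℝ) × (Fin nN → ℝ) × ℝ :=
  (fun i => max (z.1.1 i + a (Sum.inl i) * M.q i - (if dur z (Sum.inl i) = 0 then 0 else 1)) 0,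
    fun j => max (z.1.2.1 j + M.L * (if z.1.2.1 j < B then a (Sum.inr j) else 0) -
      dur z (Sum.inr j) * capacity (pow z (Sum.inr j)) (z.2 (Sum.inr j))) 0,
    max (z.1.2.2 + (∑ u, pow z u * dur z u) / M.Ts - M.Pavg) 0)

lemma Model.measurable_nextQueues (M : Model nR nN) {dur pow : SlotState nR nN → User nR nN → ℝ}
    (hdur : Measurable dur) (hpow : Measurable pow) (B : ℝ) :
    Measurable fun z : SlotState nR nN × (User nR nN → ℝ) => M.nextQueues dur pow B z.1 z.2 := by
  have h1 : ∀ i, Measurable fun z : SlotState nR nN × (User nR nN → ℝ) =>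
      if dur z.1 (Sum.inl i) = 0 then (0 : ℝ) else 1 := fun i => by
    have h : Measurable fun z : SlotState nR nN × (User nR nN → ℝ) => dur z.1 (Sum.inl i) := by
      fun_prop
    exact Measurable.ite (h (measurableSet_singleton 0)) measurable_const measurable_const
  have h2 : ∀ j, Measurable fun z : SlotState nR nN × (User nR nN → ℝ) =>
      if z.1.1.2.1 j < B then z.2 (Sum.inr j) else 0 := fun j =>
    Measurable.ite (measurableSet_lt (by fun_prop) measurable_const) (by fun_prop)
      measurable_const
  simp only [nextQueues]
  fun_prop

lemma measurable_pi_user {α : Type*} {m : MeasurableSpace α} {f : α → User nR nN → ℝ}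
    (hf : ∀ u, Measurable fun a => f a u) : Measurable f :=
  measurable_pi_lambda _ hf

namespace Realization

variable (E : Realization M)

/-- The queues under the decision rule `dur`, `pow` and the admission threshold `B`. -/
def queuePath (dur pow : SlotState nR nN → User nR nN → ℝ) (B : ℝ) :
    ℕ → E.Ω → (Fin nR → ℝ) × (Fin nN → ℝ) × ℝ
  | 0, _ => (fun _ => 0, fun _ => 0, 0)
  | k + 1, ω => M.nextQueues dur pow B (queuePath dur pow B k ω, fun u => E.gain k u ω)
      fun u => E.arr k u ω

lemma measurable_queuePath {dur pow : SlotState nR nN → User nR nN → ℝ}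
    (hdur : Measurable dur) (hpow : Measurable pow) (B : ℝ) (k : ℕ) :
    Measurable[E.ℱ k] (E.queuePath dur pow B k) := by
  induction k with
  | zero => exact measurable_const (a := (fun _ => 0, fun _ => 0, 0))
  | succ k ih =>
    have h : Measurable[E.ℱ k] (E.queuePath dur pow B (k + 1)) :=
      (M.measurable_nextQueues hdur hpow B).comp
        ((ih.prodMk (measurable_pi_user (m := E.ℱ k) (E.gain_meas k))).prodMk
          (measurable_pi_user (m := E.ℱ k) (E.arr_meas k)))
    exact h.mono (E.ℱ.mono k.le_succ) le_rfl

/-- The queues are defined from the policy and the decisions from the queues. The circle is broken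
by iterating the closed-loop recursion `queuePath` first, reading the decisions off it, and then
identifying it with the queues of the resulting policy. -/
theorem exists_isLambertStrict (hN : 0 < nN) (B : ℝ) : ∃ π : Policy E, π.IsLambertStrict B := by
  obtain ⟨dur, pow, hdur, hpow, hstep⟩ := M.exists_measurable_step hN
  have hst := E.measurable_queuePath hdur hpow B
  have hz : ∀ k, Measurable[E.ℱ k]
      fun ω => (E.queuePath dur pow B k ω, fun u => E.gain k u ω) := fun k =>
    (hst k).prodMk (measurable_pi_user (m := E.ℱ k) (E.gain_meas k))
  let π : Policy E :=
    { dur := fun k u ω => dur (E.queuePath dur pow B k ω, fun u => E.gain k u ω) u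
      pow := fun k u ω => pow (E.queuePath dur pow B k ω, fun u => E.gain k u ω) u
      adm := fun k j ω => if (E.queuePath dur pow B k ω).2.1 j < B then E.arr k (Sum.inr j) ω else 0
      dur_meas := fun k u => (measurable_pi_apply u).comp (hdur.comp (hz k))
      pow_meas := fun k u => (measurable_pi_apply u).comp (hpow.comp (hz k))
      adm_meas := fun k j => by
        have hQ : Measurable[E.ℱ k] fun ω => (E.queuePath dur pow B k ω).2.1 j :=
          (measurable_pi_apply j).comp (measurable_fst.comp (measurable_snd.comp (hst k)))
        exact Measurable.ite (hQ measurableSet_Iio) (E.arr_meas k _) measurable_const }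
  have hq : ∀ k ω, π.queues k ω = E.queuePath dur pow B k ω := fun k => by
    induction k with
    | zero => exact fun ω => rfl
    | succ k ih =>
      intro ω
      have hY : ∀ i, π.Y k i ω = (E.queuePath dur pow B k ω).1 i := fun i =>
        congrFun (congrArg (fun z => z.1) (ih ω)) i
      have hQ : ∀ j, π.Q k j ω = (E.queuePath dur pow B k ω).2.1 j := fun j =>
        congrFun (congrArg (fun z => z.2.1) (ih ω)) j
      have hX : π.X k ω = (E.queuePath dur pow B k ω).2.2 := congrArg (fun z => z.2.2) (ih ω)
      refine Prod.ext (funext fun i => ?_) (Prod.ext (funext fun j => ?_) ?_)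
      · change max (π.Y k i ω + _ - _) 0 = _
        rw [hY i]; rfl
      · change max (π.Q k j ω + _ - _) 0 = _
        rw [hQ j]; rfl
      · change max (π.X k ω + _ - _) 0 = _
        rw [hX]; rfl
  refine ⟨π, fun k => ?_⟩
  filter_upwards [E.gain_bounds k] with ω hω
  have h := hstep (π.queues k ω, fun u => E.gain k u ω) (fun j => π.Q_nonneg k j ω)
    (π.X_nonneg k ω) (fun u => (hω u).1) B (fun j => E.arr k (Sum.inr j) ω)
  rw [hq k ω] at h
  change M.LambertStrictStep B (π.queues k ω).1 (π.queues k ω).2.1 (π.queues k ω).2.2 _ _ _ _ _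
  rw [hq k ω]
  exact h

end Realization

/-! ### Limits of time averages -/

lemma limsup_le_of_le_add {f u : ℕ → ℝ} {a b : ℝ} (hb : ∀ n, b ≤ f n)
    (hf : ∀ᶠ n in atTop, f n ≤ a + u n) (hu : Tendsto u atTop (nhds 0)) :
    limsup f atTop ≤ a := by
  refine le_of_forall_pos_le_add fun ε hε => limsup_le_of_le
    (isBoundedUnder_of ⟨b, hb⟩ : IsBoundedUnder (· ≥ ·) atTop f).isCoboundedUnder_le ?_
  filter_upwards [hf, hu.eventually_lt_const hε] with n h1 h2
  linarith

lemma le_liminf_of_add_le {f u : ℕ → ℝ} {a b : ℝ} (hb : ∀ n, f n ≤ b)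
    (hf : ∀ᶠ n in atTop, a - u n ≤ f n) (hu : Tendsto u atTop (nhds 0)) :
    a ≤ liminf f atTop := by
  refine le_of_forall_pos_le_add fun ε hε => ?_
  have : a - ε ≤ liminf f atTop := le_liminf_of_le
    (isBoundedUnder_of ⟨b, hb⟩ : IsBoundedUnder (· ≤ ·) atTop f).isCoboundedUnder_ge (by
      filter_upwards [hf, hu.eventually_lt_const hε] with n h1 h2
      linarith)
  linarith

lemma tendsto_div_sqrt (c : ℝ) : Tendsto (fun K : ℕ => c / Real.sqrt K) atTop (nhds 0) :=
  tendsto_const_nhds.div_atTop (Real.tendsto_sqrt_atTop.comp tendsto_natCast_atTop_atTop)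

/-- Integrate `2 √K f ≤ f² + K` and divide: a second moment of order `K` forces a mean of order
`√K`. -/
lemma integral_div_le_of_integral_sq_le {α : Type*} [MeasurableSpace α] {μ : Measure α}
    [IsProbabilityMeasure μ] {f : α → ℝ} (hf : Integrable f μ)
    (hf2 : Integrable (fun x => f x ^ 2) μ) {c : ℝ} {K : ℕ} (hK : 0 < K)
    (h : ∫ x, f x ^ 2 ∂μ ≤ 2 * (c * K)) : (∫ x, f x ∂μ) / K ≤ (c + 1 / 2) / Real.sqrt K := by
  have hK' : (0 : ℝ) < K := Nat.cast_pos.2 hK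
  set s := Real.sqrt K with hs
  have hs0 : 0 < s := Real.sqrt_pos.2 hK'
  have hsK : s * s = K := Real.mul_self_sqrt hK'.le
  have h1 : ∫ x, 2 * s * f x ∂μ ≤ ∫ x, (f x ^ 2 + s * s) ∂μ :=
    integral_mono (hf.const_mul _) (hf2.add (integrable_const _)) fun x => by
      dsimp only
      nlinarith [sq_nonneg (f x - s)]
  rw [integral_const_mul, integral_add hf2 (integrable_const _), integral_const, probReal_univ,
    one_smul, hsK] at h1
  rw [div_le_div_iff₀ hK' hs0]
  linarith

namespace Model

lemma C₁_nonneg (M : Model nR nN) : 0 ≤ M.C₁ := by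
  rw [C₁]
  have : 0 ≤ ∑ i, (M.q i ^ 2 + 1) := Finset.sum_nonneg fun i _ => by positivity
  positivity

end Model

namespace Policy

variable {E : Realization M} {π : Policy E}

/-! ### Feasibility and throughput of the algorithm -/

/-- The one-slot estimate telescopes, starting from empty queues. -/
lemma IsLambertStrict.integral_lyapunov_le {B : ℝ} (h : π.IsLambertStrict B)
    (hG : M.IsSlotOptimum G) {d : Fin nN → ℝ}
    (hd0 : ∀ j, 0 ≤ d j ∧ d j ≤ M.L * M.lam (Sum.inr j))
    (hd : ∀ (Y : Fin nR → ℝ) (Q : Fin nN → ℝ) (X : ℝ), (∀ i, 0 ≤ Y i) → (∀ j, 0 ≤ Q j) → 0 ≤ X →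
        ∑ i, Y i * (M.lam (Sum.inl i) * M.q i) + ∑ j, Q j * d j - X * M.Pavg ≤
          ∫ g, G ((Y, Q, X), g) ∂(Measure.pi M.chan)) (K : ℕ) :
    ∫ ω, π.lyapunov K ω ∂E.P + K * (B * ∑ j, d j) ≤ K * (M.C₁ / 2) +
      B * ∑ j, ∑ k ∈ Finset.range K, M.L * ∫ ω, π.adm k j ω ∂E.P := by
  induction K with
  | zero => simp [lyapunov, Y, Q, X]
  | succ K ih =>
    have h1 := h.integral_lyapunov_succ_le hG hd0 hd K
    simp_rw [Finset.sum_range_succ]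
    rw [Finset.sum_add_distrib]
    push_cast
    linarith

/-- Only a queue below `B` admits a packet, and a packet adds at most `L` bits. -/
lemma Q_le_of_threshold {B : ℝ} (h : π.IsLambertStrict B) (hB : 0 < B) (k : ℕ) :
    ∀ᵐ ω ∂E.P, ∀ j, π.Q k j ω ≤ B + M.L := by
  have hL := M.L_pos
  induction k with
  | zero => exact Eventually.of_forall fun ω j => by simp only [Q]; linarith
  | succ k ih =>
    filter_upwards [ih, h k, h.isRegular.adm_mem k, h.isRegular.bits_mem k] with ω h1 h2 h3 h4 j
    have hadm : π.adm k j ω = if π.Q k j ω < B then E.arr k (Sum.inr j) ω else 0 := h2.1 j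
    have h5 := (h4 (Sum.inr j)).1
    rw [Q]
    refine max_le ?_ (by linarith)
    split_ifs at hadm with hQ
    · have := mul_le_mul_of_nonneg_left (h3 j).2 hL.le
      linarith
    · rw [hadm]
      linarith [h1 j]

/-- Dropping the positive part in the recursion of `X` and telescoping shows that the virtual queue
bounds the excess energy. `sum_rt_ge` does the same for the QoS deficit with `Y`. -/
lemma IsRegular.sum_slotPower_le (h : π.IsRegular) (K : ℕ) :
    ∑ k ∈ Finset.range K, ∫ ω, π.slotPower k ω ∂E.P ≤ K * M.Pavg + ∫ ω, π.X K ω ∂E.P := by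
  induction K with
  | zero => simp [X]
  | succ K ih =>
    have i1 : Integrable (fun ω => π.X K ω + π.slotPower K ω) E.P :=
      (h.integrable_X K).add (h.integrable_slotPower K)
    have h1 : ∫ ω, (π.X K ω + π.slotPower K ω - M.Pavg) ∂E.P ≤ ∫ ω, π.X (K + 1) ω ∂E.P :=
      integral_mono (i1.sub (integrable_const _)) (h.integrable_X _) fun ω => le_max_left _ _
    rw [integral_sub i1 (integrable_const _), integral_add (h.integrable_X K)
      (h.integrable_slotPower K), integral_const, probReal_univ, one_smul] at h1
    rw [Finset.sum_range_succ]
    push_cast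
    linarith

lemma IsRegular.sum_rt_ge (h : π.IsRegular) (K : ℕ) (i : Fin nR) :
    K * (M.lam (Sum.inl i) * M.q i) - ∫ ω, π.Y K i ω ∂E.P ≤
      ∑ k ∈ Finset.range K, ∫ ω, π.dur k (Sum.inl i) ω * π.rate k (Sum.inl i) ω / M.L ∂E.P := by
  induction K with
  | zero => simp [Y]
  | succ K ih =>
    have i0 := (E.integrable_arr K (Sum.inl i)).mul_const (M.q i)
    have i1 : Integrable (fun ω => π.Y K i ω + E.arr K (Sum.inl i) ω * M.q i) E.P :=
      (π.integrable_Y K i).add i0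
    have i2 := (h.integrable_bits K (Sum.inl i)).div_const M.L
    have h1 : ∫ ω, (π.Y K i ω + E.arr K (Sum.inl i) ω * M.q i -
        π.dur K (Sum.inl i) ω * π.rate K (Sum.inl i) ω / M.L) ∂E.P ≤
        ∫ ω, π.Y (K + 1) i ω ∂E.P := by
      refine integral_mono_ae (i1.sub i2) (π.integrable_Y _ i) ?_
      filter_upwards [h.rt_bits K] with ω hω
      rw [hω i]
      exact le_max_left _ _
    rw [integral_sub i1 i2, integral_add (π.integrable_Y K i) i0, integral_mul_const,
      E.integral_arr] at h1
    rw [Finset.sum_range_succ]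
    push_cast
    linarith

/-- The algorithm meets all constraints of the problem as soon as some policy does. -/
theorem IsLambertStrict.isFeasible {B : ℝ} (h : π.IsLambertStrict B) (hB : 0 < B)
    (hG : M.IsSlotOptimum G) {d : Fin nN → ℝ}
    (hd0 : ∀ j, 0 ≤ d j ∧ d j ≤ M.L * M.lam (Sum.inr j))
    (hd : ∀ (Y : Fin nR → ℝ) (Q : Fin nN → ℝ) (X : ℝ), (∀ i, 0 ≤ Y i) → (∀ j, 0 ≤ Q j) → 0 ≤ X →
        ∑ i, Y i * (M.lam (Sum.inl i) * M.q i) + ∑ j, Q j * d j - X * M.Pavg ≤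
          ∫ g, G ((Y, Q, X), g) ∂(Measure.pi M.chan)) : π.IsFeasible := by
  have hr := h.isRegular
  have hL := M.L_pos
  -- Growth rate of the mean Lyapunov function, with at most one packet admitted per NRT user and
  -- slot and the nonnegative term `B ∑ d` dropped.
  set c := M.C₁ / 2 + B * (nN * M.L) with hc
  have hlyap : ∀ K, ∫ ω, π.lyapunov K ω ∂E.P ≤ c * K := fun K => by
    have h1 := h.integral_lyapunov_le hG hd0 hd K
    have h2 : 0 ≤ K * (B * ∑ j, d j) := mul_nonneg (Nat.cast_nonneg _)
      (mul_nonneg hB.le (Finset.sum_nonneg fun j _ => (hd0 j).1))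
    have hadm : ∀ k j, ∫ ω, π.adm k j ω ∂E.P ≤ 1 := fun k j => by
      simpa using integral_mono_ae (hr.integrable_adm k j) (integrable_const (1 : ℝ))
        ((hr.adm_mem k).mono fun ω h1 => (h1 j).2)
    have h3 : ∑ j, ∑ k ∈ Finset.range K, M.L * ∫ ω, π.adm k j ω ∂E.P ≤
        ∑ _j : Fin nN, ∑ _k ∈ Finset.range K, M.L :=
      Finset.sum_le_sum fun j _ => Finset.sum_le_sum fun k _ =>
        mul_le_of_le_one_right hL.le (hadm k j)
    simp only [Finset.sum_const, Finset.card_range, Finset.card_univ, Fintype.card_fin,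
      nsmul_eq_mul] at h3
    have h4 := mul_le_mul_of_nonneg_left h3 hB.le
    rw [hc]
    linarith
  have hX : ∀ K : ℕ, 0 < K → (∫ ω, π.X K ω ∂E.P) / K ≤ (c + 1 / 2) / Real.sqrt K :=
    fun K hK => by
      refine integral_div_le_of_integral_sq_le (hr.integrable_X K) (hr.integrable_sq_X K) hK ?_
      have : ∫ ω, π.X K ω ^ 2 ∂E.P ≤ ∫ ω, 2 * π.lyapunov K ω ∂E.P :=
        integral_mono (hr.integrable_sq_X K) ((hr.integrable_lyapunov K).const_mul 2) fun ω => by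
          have h1 : 0 ≤ ∑ i, π.Y K i ω ^ 2 := Finset.sum_nonneg fun _ _ => sq_nonneg _
          have h2 : 0 ≤ ∑ j, π.Q K j ω ^ 2 := Finset.sum_nonneg fun _ _ => sq_nonneg _
          simp only [lyapunov]
          linarith
      rw [integral_const_mul] at this
      linarith [hlyap K]
  have hY : ∀ (i : Fin nR) (K : ℕ), 0 < K →
      (∫ ω, π.Y K i ω ∂E.P) / K ≤ (c + 1 / 2) / Real.sqrt K := fun i K hK => by
    refine integral_div_le_of_integral_sq_le (π.integrable_Y K i) (hr.integrable_sq_Y K i) hK ?_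
    have : ∫ ω, π.Y K i ω ^ 2 ∂E.P ≤ ∫ ω, 2 * π.lyapunov K ω ∂E.P :=
      integral_mono (hr.integrable_sq_Y K i) ((hr.integrable_lyapunov K).const_mul 2) fun ω => by
        have h1 : π.Y K i ω ^ 2 ≤ ∑ i, π.Y K i ω ^ 2 :=
          Finset.single_le_sum (f := fun i => π.Y K i ω ^ 2) (fun _ _ => sq_nonneg _)
            (Finset.mem_univ i)
        have h2 : 0 ≤ ∑ j, π.Q K j ω ^ 2 := Finset.sum_nonneg fun _ _ => sq_nonneg _
        have h3 := sq_nonneg (π.X K ω)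
        simp only [lyapunov]
        linarith
    rw [integral_const_mul] at this
    linarith [hlyap K]
  refine ⟨hr.admission, fun j => ?_, fun i => ?_, ?_, fun k => ?_, fun k => ?_, fun k => ?_,
    fun k => ?_⟩
  · refine lt_of_le_of_lt (limsup_le_of_le (a := ENNReal.ofReal (B + M.L)) (by isBoundedDefault)
      (Eventually.of_forall fun k => ?_)) ENNReal.ofReal_lt_top
    calc ∫⁻ ω, ENNReal.ofReal (π.Q k j ω) ∂E.P ≤ ∫⁻ _ω, ENNReal.ofReal (B + M.L) ∂E.P :=
          lintegral_mono_ae ((Q_le_of_threshold h hB k).mono fun ω h1 =>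
            ENNReal.ofReal_le_ofReal (h1 j))
      _ = ENNReal.ofReal (B + M.L) := by simp
  · refine le_liminf_of_add_le (fun K => (hr.timeAvg_rt_mem i K).2) ?_ (tendsto_div_sqrt (c + 1 / 2))
    filter_upwards [eventually_gt_atTop 0] with K hK
    have hK' : (0 : ℝ) < K := Nat.cast_pos.2 hK
    have h1 := div_le_div_of_nonneg_right (hr.sum_rt_ge K i) hK'.le
    rw [sub_div, mul_div_cancel_left₀ _ hK'.ne'] at h1
    have h2 := hY i K hK
    rw [timeAvg]
    linarith
  · refine limsup_le_of_le_add (fun K => (hr.timeAvg_slotPower_mem K).1) ?_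
      (tendsto_div_sqrt (c + 1 / 2))
    filter_upwards [eventually_gt_atTop 0] with K hK
    have hK' : (0 : ℝ) < K := Nat.cast_pos.2 hK
    have h1 := div_le_div_of_nonneg_right (hr.sum_slotPower_le K) hK'.le
    rw [add_div, mul_div_cancel_left₀ _ hK'.ne'] at h1
    have h2 := hX K hK
    rw [timeAvg]
    linarith
  · exact (hr.admissible k).mono fun ω h1 => h1.pow_mem
  · exact (hr.admissible k).mono fun ω h1 => h1.dur_nonneg
  · exact (hr.admissible k).mono fun ω h1 => h1.dur_sum
  · exact (hr.admissible k).mono fun ω h1 => h1.rt_packet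

/-- The throughput of the algorithm is within `C₁ / (L B)` of the delivery rates `d`. -/
theorem IsLambertStrict.le_throughput {B : ℝ} (h : π.IsLambertStrict B) (hB : 0 < B)
    (hG : M.IsSlotOptimum G) {d : Fin nN → ℝ}
    (hd0 : ∀ j, 0 ≤ d j ∧ d j ≤ M.L * M.lam (Sum.inr j))
    (hd : ∀ (Y : Fin nR → ℝ) (Q : Fin nN → ℝ) (X : ℝ), (∀ i, 0 ≤ Y i) → (∀ j, 0 ≤ Q j) → 0 ≤ X →
        ∑ i, Y i * (M.lam (Sum.inl i) * M.q i) + ∑ j, Q j * d j - X * M.Pavg ≤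
          ∫ g, G ((Y, Q, X), g) ∂(Measure.pi M.chan)) :
    (∑ j, d j) / M.L - M.C₁ / (M.L * B) ≤ π.throughput := by
  have hr := h.isRegular
  have hL := M.L_pos
  -- In packets, the largest total backlog the threshold permits; it is the difference between
  -- admitted and delivered data and vanishes after division by `K`.
  set b : ℝ := nN * (B + M.L) / M.L
  refine le_liminf_of_add_le (u := fun K => b / K) (fun K => (hr.timeAvg_throughput_mem K).2) ?_
    (tendsto_const_div_atTop_nhds_zero_nat b)
  filter_upwards [eventually_gt_atTop 0] with K hK
  have hK' : (0 : ℝ) < K := Nat.cast_pos.2 hK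
  rw [hr.timeAvg_throughput]
  simp only [timeAvg, hr.sum_integral_delivered]
  rw [← Finset.sum_div, Finset.sum_sub_distrib]
  have h1 := h.integral_lyapunov_le hG hd0 hd K
  have h2 : 0 ≤ ∫ ω, π.lyapunov K ω ∂E.P := integral_nonneg fun ω => by
    simp only [lyapunov, Pi.zero_apply]
    positivity
  have h3 : ∑ j, ∫ ω, π.Q K j ω ∂E.P ≤ nN * (B + M.L) := by
    have : ∑ j, ∫ ω, π.Q K j ω ∂E.P ≤ ∑ _j : Fin nN, (B + M.L) :=
      Finset.sum_le_sum fun j _ => by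
        simpa using integral_mono_ae (hr.integrable_Q K j) (integrable_const (B + M.L))
          ((Q_le_of_threshold h hB K).mono fun ω h1 => h1 j)
    simpa [mul_add] using this
  set A := ∑ j, ∑ k ∈ Finset.range K, M.L * ∫ ω, π.adm k j ω ∂E.P
  have h4 : K * (∑ j, d j) - K * (M.C₁ / B) ≤ A := by
    -- The drift bound holds with `C₁ / 2`; the stated constant is weaker by a factor of two.
    have h5 : K * (B * ∑ j, d j) ≤ K * M.C₁ + B * A := by
      have := mul_nonneg hK'.le (M.C₁_nonneg)
      linarith
    have h6 : B * (K * (∑ j, d j) - K * (M.C₁ / B)) = K * (B * ∑ j, d j) - K * M.C₁ := by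
      field_simp
    exact le_of_mul_le_mul_left (by linarith) hB
  have e : (∑ j, d j) / M.L - M.C₁ / (M.L * B) - b / K =
      (K * (∑ j, d j) - K * (M.C₁ / B) - nN * (B + M.L)) / K / M.L := by
    simp only [b]
    field_simp
  rw [e]
  gcongr

end Policy
end Downlink
end

/-! ### Proof of the theorem -/

theorem mainTheorem1 {nR nN : ℕ} (hN : 0 < nN) (M : Downlink.Model nR nN)
    (hfeas : M.Feasible) (Bmax : ℝ) (hB : 0 < Bmax) :
    BddAbove M.achievable ∧
    ∀ E : Downlink.Realization M,
      (∃ π : Downlink.Policy E, π.IsLambertStrict Bmax) ∧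
      ∀ π : Downlink.Policy E, π.IsLambertStrict Bmax →
        π.IsFeasible ∧ M.optThroughput - M.C₁ / (M.L * Bmax) ≤ π.throughput := by
  obtain ⟨G, hG⟩ := M.exists_measurable_optimum hN
  have hG : M.IsSlotOptimum G := hG
  have hL := M.L_pos
  refine ⟨⟨nN, ?_⟩, fun E => ⟨E.exists_isLambertStrict hN Bmax, fun π hπ => ⟨?_, ?_⟩⟩⟩
  · rintro v ⟨E, π, hπ, rfl⟩
    exact hπ.isRegular.throughput_le
  -- The feasible policy may live on another probability space. Only its rates `d` and their
  -- inequality, stated through the channel laws, are carried over to `E`.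
  · obtain ⟨E', π', hπ'⟩ := hfeas
    obtain ⟨d, hd0, -, hd⟩ := hπ'.exists_rates hG
    exact hπ.isFeasible hB hG hd0 hd
  · rw [sub_le_iff_le_add]
    refine csSup_le ?_ ?_
    · obtain ⟨E', π', hπ'⟩ := hfeas
      exact ⟨_, E', π', hπ', rfl⟩
    · rintro v ⟨E', π', hπ', rfl⟩
      obtain ⟨d, hd0, hv, hd⟩ := hπ'.exists_rates hG
      have h1 := hπ.le_throughput hB hG hd0 hd
      have h2 : π'.throughput ≤ (∑ j, d j) / M.L := by
        rw [le_div_iff₀ hL, mul_comm]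
        exact hv
      linarith
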